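/- **Setting.** Let $W,V,X$ be bits with joint law $p(w,v)\,p(x|v)$, and let $p(y_1,y_3|x)\,p(y_2|y_1)$ be a discrete memoryless three-receiver broadcast channel with input alphabet $\{0,1\}$ and arbitrary discrete output alphabets. Let $0<\beta<1/2$, $N=2^n$ with $n\ge 1$, $\delta_n=2^{-N^\beta}$, and let $G_N=B_NF^{\otimes n}$ be Arıkan's polar transform, with $F=\begin{pmatrix}1&0\\1&1\end{pmatrix}$ and $B_N$ the bit reversal. Let $P$ be the law under which the letters $(W_i,V_i,X_i,Y_{1,i},Y_{2,i},Y_{3,i})$, $1\le i\le N$, are i.i.d., and put $U_w=W^{1:N}G_N$, $U_v=V^{1:N}G_N$, $U_x=X^{1:N}G_N$. For a bit $B$ let $Z(B|S)=2\sum_s P(s)\sqrt{P(1|s)P(0|s)}$. In layer $w$, $\mathcal H_W$ and $\mathcal L_W$ are the sets of $i$ with $Z((U_w)_i|U_w^{1:i-1})\ge 1-\delta_n$, respectively $\le\delta_n$, $R^w$ is the complement of their union, $\mathcal L_{W|Y_j}$ is the set of $i$ with $Z((U_w)_i|U_w^{1:i-1},Y_j^{1:N})\le\delta_n$, $I^w_j=\mathcal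 L_{W|Y_j}\cap\mathcal H_W$ and $F^w_j=\mathcal H_W\setminus I^w_j$. In layers $v$ and $x$ the sets $\mathcal H_{V|W},\mathcal L_{V|W},R^v,I^v_j,F^v_j$ and $\mathcal H_{X|V},\mathcal L_{X|V},R^x,I^x_j,F^x_j$ are defined in the same way, with additional conditioning on $W^{1:N}$, respectively $V^{1:N}$. Conditional probabilities given events of $P$-probability $0$ are taken to be uniform, and $\operatorname{argmax}$ over $\{0,1\}$ resolves ties in favour of $0$. **Random chaining construction** with $k\ge1$ blocks of length $N$, for integers $NR_0,NR_{11},NR_{12}\ge0$. One of the following allocations is chosen (all subsets of the sizes stated, and all bijections used for copying, are allowed). (a) $NR_0\ge|I_3^w|$. Public bits are put into $(U_w)^{I_3^w\cap I_2^w}$ in every block and, in every block but the last, into $(U_w)^{I_3^w\cap F_2^w}$ and $(U_v)^{S}$, where $|S|=NR_0-|I_3^w|$. The bits of $(U_w)^{I_3^w\cap F_2^w}$ and $(U_v)^{S}$ of each block but the last are copied bijectively to a set $(U_w)^{T}$ of the next block, $T\subseteq I_2^w\cap F_3^w$. (a1) If $NR_{11}>|I_1^v\cap I_3^v|$, then $S\subseteq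 I_3^v\cap F_1^v$; private bits are put into $(U_v)^{I_1^v\cap I_3^v}$ in every block and, in every block but the last, into $(U_v)^{S'}$, where $S'\subseteq (I_3^v\cap F_1^v)\setminus S$ and $|S'|=NR_{11}-|I_1^v\cap I_3^v|$; the latter are copied bijectively to a set $(U_v)^{T'}$ of the next block, $T'\subseteq I_1^v\cap F_3^v$. (a2) If $NR_{11}\le|I_1^v\cap I_3^v|$, private bits are put into $(U_v)^{S''}$ in every block, where $S''\subseteq I_1^v\cap I_3^v$, $|S''|=NR_{11}$, and $S\subseteq I_3^v\setminus S''$. (b1) $|I_2^w\cap I_3^w|<NR_0\le|I_3^w|$. Public bits are put into $(U_w)^{I_3^w\cap I_2^w}$ in every block and, in every block but the last, into a set $(U_w)^{S_0}$, where $S_0\subseteq I_3^w\cap F_2^w$ and $|S_0|=NR_0-|I_3^w\cap I_2^w|$; the latter are copied bijectively to a set $(U_w)^{T}$ of the next block, $T\subseteq I_2^w\cap F_3^w$. Private bits are put into $NR_{11}$ positions of $(U_v)^{I_1^v}$ in every block. (b2) $NR_0\le|I_2^w\cap I_3^w|$. Public bits are put into $NR_0$ positions of $(U_w)^{I_2^w\cap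 I_3^w}$ and private bits into $NR_{11}$ positions of $(U_v)^{I_1^v}$ in every block, without copying. In all cases private bits are also put into $NR_{12}$ positions of $(U_x)^{I_1^x}$ in every block. The public bits form the message $M_0$ and the private bits the message $M_1$; they are independent and uniform. All other positions in $\mathcal H_W,\mathcal H_{V|W},\mathcal H_{X|V}$ of all blocks carry i.i.d. uniform frozen bits, which form the random code $\mathbb C$; those in $F_j^w,F_j^v,F_j^x$ are shared with receiver $j$. In each block the positions are filled in the order $U_w$, $U_v$, $U_x$ and successively within each layer: a bit with $i\in\mathcal L_W$ is $\operatorname{argmax}_b P_{(U_w)_i|U_w^{1:i-1}}(b|u_w^{1:i-1})$, and a bit with $i\in R^w$ is drawn with the conditional law $P_{(U_w)_i|U_w^{1:i-1}}(\cdot|u_w^{1:i-1})$ by means of common randomness: a random Boolean function of the past, shared with the receivers, independent over positions, layers and blocks. Layers $v$ and $x$ are treated in the same way, conditionally also on $w^{1:N}=u_wG_N$, respectively $v^{1:N}=u_vG_N$. The codewords $x^{1:N}=u_xG_N$ of all blocks are transmitted. Decoding is by successive cancellation, layer by layer. At receiver $j$ the copied bits known from the neighbouring block are inserted; the other bits in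 $I_j^w\cup\mathcal L_W$, $I_j^v\cup\mathcal L_{V|W}$, $I_j^x\cup\mathcal L_{X|V}$ are found by the $\operatorname{argmax}$ rule for the conditional law given also $y_j^{1:N}$; the bits in $R^w,R^v,R^x$ come from the common randomness and the remaining ones are the shared frozen bits. Receiver 3 processes the blocks in increasing order (inserting at the copy targets), receivers 1 and 2 in decreasing order (inserting at the copy sources). $P_e(\mathbb C)$ is the probability that receiver 1 errs about $(M_0,M_1)$, or receiver 2 or receiver 3 errs about $M_0$. **Theorem 1.** (1) For every block and all $u_w,u_v,u_x\in\{0,1\}^N$, $$\mathbb E_{\mathbb C}\big[\mathbb P(U_w^{1:N}=u_w,U_v^{1:N}=u_v,U_x^{1:N}=u_x\mid\mathbb C)\big]=Q(u_w,u_v,u_x),$$ where, with $w^{1:N}=u_wG_N$, $v^{1:N}=u_vG_N$ and $\delta_i(b|\cdot)=1$ if $b$ is the $\operatorname{argmax}$ of the respective conditional law and $0$ otherwise, $$\begin{aligned}Q={}&2^{-|\mathcal H_W|}\prod_{i\in\mathcal L_W}\delta^w_i((u_w)_i|u_w^{1:i-1})\prod_{i\in R^w}P((u_w)_i|u_w^{1:i-1})\\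 &\cdot2^{-|\mathcal H_{V|W}|}\prod_{i\in\mathcal L_{V|W}}\delta^v_i((u_v)_i|w^{1:N},u_v^{1:i-1})\prod_{i\in R^v}P((u_v)_i|w^{1:N},u_v^{1:i-1})\\ &\cdot2^{-|\mathcal H_{X|V}|}\prod_{i\in\mathcal L_{X|V}}\delta^x_i((u_x)_i|v^{1:N},u_x^{1:i-1})\prod_{i\in R^x}P((u_x)_i|v^{1:N},u_x^{1:i-1}).\end{aligned}$$ (2) For every $\beta'<\beta$ we have $\mathbb E_{\mathbb C}[P_e(\mathbb C)]=O(k\,2^{-N^{\beta'}})$: there is a constant $K$, depending only on $\beta,\beta'$, the law $p(w,v)p(x|v)$ and the channel, such that $\mathbb E_{\mathbb C}[P_e(\mathbb C)]\le K\,k\,2^{-N^{\beta'}}$ for all $n\ge1$, all $k\ge1$ and all choices in the construction. -/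

import Mathlib

open scoped ENNReal Matrix

/-! Product of probability mass functions, and expectations. -/

namespace PolarBC

theorem tsum_pi_fin : ∀ (n : ℕ) {α : Fin n → Type*} (p : ∀ i, α i → ℝ≥0∞),
    (∀ i, ∑' a, p i a = 1) → ∑' a : (∀ i, α i), ∏ i, p i (a i) = 1
  | 0, α, p, _ => by
      rw [tsum_eq_single (fun i => i.elim0 : ∀ i, α i)
        (fun b hb => absurd (Subsingleton.elim _ _) hb)]
      simp
  | n + 1, α, p, h => by
      rw [← (Fin.consEquiv α).tsum_eq, ENNReal.tsum_prod']
      have h2 := tsum_pi_fin n (fun i => p i.succ) (fun i => h i.succ)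
      simp only [Fin.consEquiv_apply, Fin.prod_univ_succ, Fin.cons_zero, Fin.cons_succ]
      simp_rw [ENNReal.tsum_mul_left, h2, mul_one]
      exact h 0

theorem tsum_pi {ι : Type*} [Fintype ι] {α : ι → Type*} (p : ∀ i, α i → ℝ≥0∞)
    (h : ∀ i, ∑' a, p i a = 1) : ∑' a : (∀ i, α i), ∏ i, p i (a i) = 1 := by
  classical
  let e := (Fintype.equivFin ι).symm
  rw [← (Equiv.piCongrLeft α e).tsum_eq]
  rw [← tsum_pi_fin (Fintype.card ι) (fun i => p (e i)) (fun i => h (e i))]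
  refine tsum_congr fun a => ?_
  rw [← e.prod_comp]
  refine Finset.prod_congr rfl fun i _ => ?_
  rw [Equiv.piCongrLeft_apply_apply]

/-- The law of a family of independent random variables, the `i`-th one having law `p i`. -/
noncomputable def pmfPi {ι : Type*} [Fintype ι] {α : ι → Type*} (p : ∀ i, PMF (α i)) :
    PMF (∀ i, α i) :=
  ⟨fun a => ∏ i, p i (a i), by
    have h := tsum_pi (fun i a => p i a) (fun i => (p i).tsum_coe)
    exact h ▸ ENNReal.summable.hasSum⟩

/-- Expectation of a nonnegative function. -/
noncomputable def expect {α : Type*} (p : PMF α) (f : α → ℝ≥0∞) : ℝ≥0∞ := ∑' a, p a * f a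

/-! Bits, layers, receivers, and the polar transform. -/

abbrev Bit := ZMod 2

/-- Words of block length `N = 2 ^ n`. -/
abbrev Word (n : ℕ) := Fin (2 ^ n) → Bit

/-- The three superposition layers. -/
inductive Layer
  | w | v | x
  deriving DecidableEq

instance : Fintype Layer :=
  ⟨{.w, .v, .x}, fun l => by cases l <;> simp⟩

/-- The three receivers. -/
inductive Rcv
  | r1 | r2 | r3

/-- The polar transform `G_N = B_N F^{⊗ n}`: `F` is the kernel and `B_N` is bit reversal. -/
def polarG (n : ℕ) : Matrix (Fin (2 ^ n)) (Fin (2 ^ n)) Bit := fun i j =>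
  ∏ a : Fin n, (!![1, 0; 1, 1] : Matrix (Fin 2) (Fin 2) Bit)
    (if i.val.testBit (n - 1 - a.val) then 1 else 0) (if j.val.testBit a.val then 1 else 0)

/-- `u ↦ u G_N`. -/
def polar {n : ℕ} (u : Word n) : Word n := u ᵥ* polarG n

/-- The conditioning word of a layer, as a function of the words `W, V, X`: nothing (a constant)
for layer `w`, the word `W` for layer `v`, the word `V` for layer `x`. -/
def parent {n : ℕ} (a : Layer → Word n) : Layer → Word n
  | .w => 0
  | .v => a .w
  | .x => a .v

/-- The first `i` bits `u^{1:i-1}` preceding position `i` (positions are numbered from `0`). -/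
def past {n : ℕ} (u : Word n) (i : Fin (2 ^ n)) : Fin i.val → Bit :=
  fun m => u ⟨m.val, m.isLt.trans i.isLt⟩

/-- What bit `i` of a layer is conditioned on: the conditioning word and the previous bits. -/
abbrev Ctx (n : ℕ) (i : Fin (2 ^ n)) := Word n × (Fin i.val → Bit)

/-! The broadcast channel, the i.i.d. source, and the bit-channel sets. -/

/-- A joint law `p(w,v) p(x|v)` of bits and a discrete memoryless multi-level three-receiver
broadcast channel `p(y₁,y₃|x) p(y₂|y₁)`. The output alphabets are arbitrary discrete ones. -/
structure Model (Y : Rcv → Type*) where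
  pWV : PMF (Bit × Bit)
  pXV : Bit → PMF Bit
  pY13 : Bit → PMF (Y .r1 × Y .r3)
  pY2 : Y .r1 → PMF (Y .r2)

section Source

variable {Y : Rcv → Type*}

/-- The law of the outputs of one use of the channel. -/
noncomputable def Model.chan (M : Model Y) (x : Bit) : PMF (∀ j, Y j) :=
  (M.pY13 x).bind fun y13 => (M.pY2 y13.1).map fun y2 => fun
    | .r1 => y13.1
    | .r2 => y2
    | .r3 => y13.2

/-- The joint law of `(W, V, X)` and `(Y₁, Y₂, Y₃)`. -/
noncomputable def Model.letterLaw (M : Model Y) : PMF ((Layer → Bit) × (∀ j, Y j)) :=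
  M.pWV.bind fun wv => (M.pXV wv.2).bind fun x => (M.chan x).map fun y =>
    ((fun | .w => wv.1 | .v => wv.2 | .x => x), y)

/-- Outcomes of `N = 2 ^ n` uses: `i ↦ ((W_i, V_i, X_i), (Y_{1,i}, Y_{2,i}, Y_{3,i}))`. -/
abbrev Outcome (Y : Rcv → Type*) (n : ℕ) := Fin (2 ^ n) → (Layer → Bit) × (∀ j, Y j)

/-- The law `P`, under which the `N` letters are i.i.d. -/
noncomputable def Model.iidLaw (M : Model Y) (n : ℕ) : PMF (Outcome Y n) :=
  pmfPi fun _ => M.letterLaw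

/-- The words `W^{1:N}`, `V^{1:N}`, `X^{1:N}`. -/
def wordOf {n : ℕ} (o : Outcome Y n) (l : Layer) : Word n := fun i => (o i).1 l

/-- The received word `Y_j^{1:N}`. -/
def outOf {n : ℕ} (j : Rcv) (o : Outcome Y n) : Fin (2 ^ n) → Y j := fun i => (o i).2 j

/-- `U_w = W G_N`, `U_v = V G_N`, `U_x = X G_N`. -/
def uOf {n : ℕ} (o : Outcome Y n) (l : Layer) : Word n := polar (wordOf o l)

def ctxOf {n : ℕ} (l : Layer) (i : Fin (2 ^ n)) (o : Outcome Y n) : Ctx n i :=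
  (parent (wordOf o) l, past (uOf o l) i)

def ctxOutOf {n : ℕ} (j : Rcv) (l : Layer) (i : Fin (2 ^ n)) (o : Outcome Y n) :
    Ctx n i × (Fin (2 ^ n) → Y j) :=
  (ctxOf l i o, outOf j o)

/-- The conditional probability `P(B = b | S = s)`; by convention it is uniform in `b` where
`P(S = s) = 0`. -/
noncomputable def condBit {Ω σ : Type*} (P : PMF Ω) (B : Ω → Bit) (S : Ω → σ) (s : σ) (b : Bit) :
    ℝ≥0∞ :=
  open Classical in
  if P.map S s = 0 then 2⁻¹ else P.map (fun o => (S o, B o)) (s, b) / P.map S s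

/-- The Bhattacharyya parameter `Z(B | S) = 2 ∑ₛ P(s) √(P(1|s) P(0|s))`. -/
noncomputable def bhatt {Ω σ : Type*} (P : PMF Ω) (B : Ω → Bit) (S : Ω → σ) : ℝ≥0∞ :=
  2 * ∑' s, P.map S s * (condBit P B S s 1 * condBit P B S s 0) ^ (1 / 2 : ℝ)

/-- A maximizer of `f` over `{0, 1}` (ties are resolved in favour of `0`). -/
noncomputable def argmaxBit (f : Bit → ℝ≥0∞) : Bit :=
  open Classical in if f 1 ≤ f 0 then 0 else 1

/-- `P(U_i = b | parent word, U^{1:i-1})` in layer `l`. -/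
noncomputable def Model.encProb (M : Model Y) (n : ℕ) (l : Layer) (i : Fin (2 ^ n)) (s : Ctx n i)
    (b : Bit) : ℝ≥0∞ :=
  condBit (M.iidLaw n) (fun o => uOf o l i) (ctxOf l i) s b

/-- `P(U_i = b | parent word, U^{1:i-1}, Y_j^{1:N})` in layer `l`. -/
noncomputable def Model.decProb (M : Model Y) (n : ℕ) (j : Rcv) (l : Layer) (i : Fin (2 ^ n))
    (s : Ctx n i) (y : Fin (2 ^ n) → Y j) (b : Bit) : ℝ≥0∞ :=
  condBit (M.iidLaw n) (fun o => uOf o l i) (ctxOutOf j l i) (s, y) b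

/-- `δ_n = 2 ^ (- N ^ β)`. -/
noncomputable def delta (β : ℝ) (n : ℕ) : ℝ := (2 : ℝ) ^ (-(((2 : ℝ) ^ n) ^ β))

/-- `H_W`, `H_{V|W}`, `H_{X|V}`. -/
noncomputable def Model.setH (M : Model Y) (n : ℕ) (β : ℝ) (l : Layer) : Finset (Fin (2 ^ n)) :=
  open Classical in
  Finset.univ.filter fun i => ENNReal.ofReal (1 - delta β n) ≤
    bhatt (M.iidLaw n) (fun o => uOf o l i) (ctxOf l i)

/-- `L_W`, `L_{V|W}`, `L_{X|V}`. -/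
noncomputable def Model.setL (M : Model Y) (n : ℕ) (β : ℝ) (l : Layer) : Finset (Fin (2 ^ n)) :=
  open Classical in
  Finset.univ.filter fun i =>
    bhatt (M.iidLaw n) (fun o => uOf o l i) (ctxOf l i) ≤ ENNReal.ofReal (delta β n)

/-- The not completely polarized positions `R^w`, `R^v`, `R^x`. -/
noncomputable def Model.setR (M : Model Y) (n : ℕ) (β : ℝ) (l : Layer) : Finset (Fin (2 ^ n)) :=
  (M.setH n β l ∪ M.setL n β l)ᶜ

/-- `L_{W|Y_j}`, `L_{V|W Y_j}`, `L_{X|V Y_j}`. -/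
noncomputable def Model.setLY (M : Model Y) (n : ℕ) (β : ℝ) (j : Rcv) (l : Layer) :
    Finset (Fin (2 ^ n)) :=
  open Classical in
  Finset.univ.filter fun i =>
    bhatt (M.iidLaw n) (fun o => uOf o l i) (ctxOutOf j l i) ≤ ENNReal.ofReal (delta β n)

/-- The information positions `I_j^w`, `I_j^v`, `I_j^x` of receiver `j`. -/
noncomputable def Model.setI (M : Model Y) (n : ℕ) (β : ℝ) (j : Rcv) (l : Layer) :
    Finset (Fin (2 ^ n)) :=
  M.setLY n β j l ∩ M.setH n β l

/-- The frozen positions `F_j^w`, `F_j^v`, `F_j^x` of receiver `j`. -/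
noncomputable def Model.setF (M : Model Y) (n : ℕ) (β : ℝ) (j : Rcv) (l : Layer) :
    Finset (Fin (2 ^ n)) :=
  M.setH n β l \ M.setI n β j l

/-- The measure `Q` on `(U_w, U_v, U_x)`: in each layer uniform on the high-entropy positions,
argmax-deterministic on the low-entropy ones, true conditionals on the remaining ones. -/
noncomputable def Model.Q (M : Model Y) (n : ℕ) (β : ℝ) (u : Layer → Word n) : ℝ≥0∞ :=
  ∏ l : Layer,
    ((2⁻¹ : ℝ≥0∞) ^ (M.setH n β l).card *
      (∏ i ∈ M.setL n β l,
        if u l i = argmaxBit (M.encProb n l i (parent (fun l' => polar (u l')) l, past (u l) i))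
          then 1 else 0) *
      ∏ i ∈ M.setR n β l,
        M.encProb n l i (parent (fun l' => polar (u l')) l, past (u l) i) (u l i))

end Source

/-! Two-level chaining: which positions carry what. -/

/-- A choice of index sets for the chaining construction, the same in every block.
* `pubW`: layer-`w` positions with public bits in all blocks;
* `chainW`, `chainV`: layer-`w` and layer-`v` positions with public bits in all blocks but the
  last, which are repeated in the positions `tgtW` of layer `w` of the next block;
* `privV`, `privX`: layer-`v` and layer-`x` positions with private bits in all blocks;
* `chainP`: layer-`v` positions with private bits in all blocks but the last, which are
  repeated in the positions `tgtV` of layer `v` of the next block.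

In the last block the positions `chainW`, `chainV`, `chainP` are frozen, in the first block the
positions `tgtW`, `tgtV` are. -/
structure Alloc (n : ℕ) where
  pubW : Finset (Fin (2 ^ n))
  chainW : Finset (Fin (2 ^ n))
  chainV : Finset (Fin (2 ^ n))
  tgtW : Finset (Fin (2 ^ n))
  privV : Finset (Fin (2 ^ n))
  chainP : Finset (Fin (2 ^ n))
  tgtV : Finset (Fin (2 ^ n))
  privX : Finset (Fin (2 ^ n))
  pubLink : (chainW ⊕ chainV) ≃ tgtW
  privLink : chainP ≃ tgtV

section Allocation

variable {Y : Rcv → Type*} {n : ℕ}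

/-- The case `N R₀ ≥ |I_3^w|` (indirect coding for receiver 3) with `N R₁₁ > |I_1^v ∩ I_3^v|`. -/
def Alloc.IndirectTwoLevel (A : Alloc n) (M : Model Y) (β : ℝ) (m0 m11 : ℕ) : Prop :=
  A.pubW = M.setI n β .r3 .w ∩ M.setI n β .r2 .w ∧
  A.chainW = M.setI n β .r3 .w ∩ M.setF n β .r2 .w ∧
  A.chainV ⊆ M.setI n β .r3 .v ∩ M.setF n β .r1 .v ∧
  A.chainV.card + (M.setI n β .r3 .w).card = m0 ∧
  A.tgtW ⊆ M.setI n β .r2 .w ∩ M.setF n β .r3 .w ∧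
  (M.setI n β .r1 .v ∩ M.setI n β .r3 .v).card < m11 ∧
  A.privV = M.setI n β .r1 .v ∩ M.setI n β .r3 .v ∧
  A.chainP ⊆ (M.setI n β .r3 .v ∩ M.setF n β .r1 .v) \ A.chainV ∧
  A.chainP.card + (M.setI n β .r1 .v ∩ M.setI n β .r3 .v).card = m11 ∧
  A.tgtV ⊆ M.setI n β .r1 .v ∩ M.setF n β .r3 .v

/-- The case `N R₀ ≥ |I_3^w|` with `N R₁₁ ≤ |I_1^v ∩ I_3^v|`: no second level of chaining; the
chained public bits of layer `v` may use all of `I_3^v` that is left free by the private bits. -/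
def Alloc.IndirectOneLevel (A : Alloc n) (M : Model Y) (β : ℝ) (m0 m11 : ℕ) : Prop :=
  A.pubW = M.setI n β .r3 .w ∩ M.setI n β .r2 .w ∧
  A.chainW = M.setI n β .r3 .w ∩ M.setF n β .r2 .w ∧
  A.chainV ⊆ M.setI n β .r3 .v \ A.privV ∧
  A.chainV.card + (M.setI n β .r3 .w).card = m0 ∧
  A.tgtW ⊆ M.setI n β .r2 .w ∩ M.setF n β .r3 .w ∧
  A.privV ⊆ M.setI n β .r1 .v ∩ M.setI n β .r3 .v ∧
  A.privV.card = m11 ∧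
  A.chainP = ∅ ∧ A.tgtV = ∅

/-- The case `|I_2^w ∩ I_3^w| < N R₀ ≤ |I_3^w|`: chaining within layer `w` only. -/
def Alloc.DirectChained (A : Alloc n) (M : Model Y) (β : ℝ) (m0 m11 : ℕ) : Prop :=
  (M.setI n β .r3 .w ∩ M.setI n β .r2 .w).card < m0 ∧
  A.pubW = M.setI n β .r3 .w ∩ M.setI n β .r2 .w ∧
  A.chainW ⊆ M.setI n β .r3 .w ∩ M.setF n β .r2 .w ∧
  A.chainW.card + (M.setI n β .r3 .w ∩ M.setI n β .r2 .w).card = m0 ∧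
  A.chainV = ∅ ∧
  A.tgtW ⊆ M.setI n β .r2 .w ∩ M.setF n β .r3 .w ∧
  A.privV ⊆ M.setI n β .r1 .v ∧
  A.privV.card = m11 ∧
  A.chainP = ∅ ∧ A.tgtV = ∅

/-- The case `N R₀ ≤ |I_2^w ∩ I_3^w|`: no chaining. -/
def Alloc.DirectUnchained (A : Alloc n) (M : Model Y) (β : ℝ) (m0 m11 : ℕ) : Prop :=
  A.pubW ⊆ M.setI n β .r3 .w ∩ M.setI n β .r2 .w ∧
  A.pubW.card = m0 ∧
  A.chainW = ∅ ∧ A.chainV = ∅ ∧ A.tgtW = ∅ ∧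
  A.privV ⊆ M.setI n β .r1 .v ∧
  A.privV.card = m11 ∧
  A.chainP = ∅ ∧ A.tgtV = ∅

/-- `A` is an allocation of the chaining construction for `m0 = N R₀` public bits and
`m11 = N R₁₁`, `m12 = N R₁₂` private bits per block. -/
def Alloc.Valid (A : Alloc n) (M : Model Y) (β : ℝ) (m0 m11 m12 : ℕ) : Prop :=
  (A.IndirectTwoLevel M β m0 m11 ∨ A.IndirectOneLevel M β m0 m11 ∨
    A.DirectChained M β m0 m11 ∨ A.DirectUnchained M β m0 m11) ∧
  A.privX ⊆ M.setI n β .r1 .x ∧ A.privX.card = m12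

/-- The position of the previous block that a position repeats, if any. -/
def Alloc.src (A : Alloc n) : Layer → Fin (2 ^ n) → Option (Layer × Fin (2 ^ n))
  | .w, i => if h : i ∈ A.tgtW then
      some (match A.pubLink.symm ⟨i, h⟩ with
        | .inl a => (.w, a.val)
        | .inr a => (.v, a.val))
      else none
  | .v, i => if h : i ∈ A.tgtV then some (.v, (A.privLink.symm ⟨i, h⟩).val) else none
  | .x, _ => none

/-- The position of the next block in which a position is repeated, if any. -/
def Alloc.dst (A : Alloc n) : Layer → Fin (2 ^ n) → Option (Layer × Fin (2 ^ n))
  | .w, i => if h : i ∈ A.chainW then some (.w, (A.pubLink (.inl ⟨i, h⟩)).val) else none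
  | .v, i =>
      if h : i ∈ A.chainV then some (.w, (A.pubLink (.inr ⟨i, h⟩)).val)
      else if h : i ∈ A.chainP then some (.v, (A.privLink ⟨i, h⟩).val)
      else none
  | .x, _ => none

/-- A bit position of the code: block, layer, index. -/
abbrev Slot (k n : ℕ) := Fin k × Layer × Fin (2 ^ n)

def Alloc.IsPublic (A : Alloc n) {k : ℕ} : Slot k n → Prop
  | (t, .w, i) => i ∈ A.pubW ∨ (i ∈ A.chainW ∧ t.val + 1 < k)
  | (t, .v, i) => i ∈ A.chainV ∧ t.val + 1 < k
  | (_, .x, _) => False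

def Alloc.IsPrivate (A : Alloc n) {k : ℕ} : Slot k n → Prop
  | (_, .w, _) => False
  | (t, .v, i) => i ∈ A.privV ∨ (i ∈ A.chainP ∧ t.val + 1 < k)
  | (_, .x, i) => i ∈ A.privX

def Alloc.IsCopied (A : Alloc n) {k : ℕ} (s : Slot k n) : Prop :=
  0 < s.1.val ∧ (A.src s.2.1 s.2.2).isSome

/-- The frozen slots: all the high-entropy slots not filled otherwise. -/
def Alloc.IsFrozen (A : Alloc n) (M : Model Y) (β : ℝ) {k : ℕ} (s : Slot k n) : Prop :=
  s.2.2 ∈ M.setH n β s.2.1 ∧ ¬ A.IsPublic s ∧ ¬ A.IsPrivate s ∧ ¬ A.IsCopied s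

/-- Public messages `M₀`. -/
abbrev PubMsg (A : Alloc n) (k : ℕ) := {s : Slot k n // A.IsPublic s} → Bit

/-- Private messages `M₁`. -/
abbrev PrivMsg (A : Alloc n) (k : ℕ) := {s : Slot k n // A.IsPrivate s} → Bit

/-- Values of the random code `ℂ`: the frozen bits of all blocks. -/
abbrev FrozenBits (A : Alloc n) (M : Model Y) (β : ℝ) (k : ℕ) :=
  {s : Slot k n // A.IsFrozen M β s} → Bit

/-- The uniform law of independent fair bits. -/
noncomputable def fairBits (κ : Type*) [Finite κ] : PMF (κ → Bit) :=
  open Classical in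
  letI := Fintype.ofFinite κ
  PMF.uniformOfFintype (κ → Bit)

/-- The common randomness for the not completely polarized positions: at each position a random
boolean function of the conditioning word and the previous bits is drawn, whose value at each
argument has the true conditional law. (Thresholding a shared uniform variable and drawing the
values of the function independently are both of this form.) -/
structure SharedRule (M : Model Y) (n : ℕ) (β : ℝ) where
  law : ∀ (_ : Layer) (i : Fin (2 ^ n)), PMF (Ctx n i → Bit)
  marginal : ∀ (l : Layer) (i : Fin (2 ^ n)), i ∈ M.setR n β l → ∀ (s : Ctx n i) (b : Bit),
    (law l i).map (fun f => f s) b = M.encProb n l i s b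

/-- Values of the common randomness. -/
abbrev Shared (k n : ℕ) := ∀ s : Slot k n, Ctx n s.2.2 → Bit

/-- The common randomness is independent over blocks, layers and positions. -/
noncomputable def SharedRule.sharedLaw {M : Model Y} {β : ℝ} (ρ : SharedRule M n β) (k : ℕ) :
    PMF (Shared k n) :=
  pmfPi fun s : Slot k n => ρ.law s.2.1 s.2.2

end Allocation

/-! Encoder. -/

/-- The word whose bits are determined successively: `u_i = rule i u^{1:i-1}`. -/
def seqBuild {n : ℕ} (rule : ∀ i : Fin (2 ^ n), (Fin i.val → Bit) → Bit) (i : Fin (2 ^ n)) : Bit :=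
  rule i fun m => seqBuild rule ⟨m.val, m.isLt.trans i.isLt⟩
termination_by i.val
decreasing_by exact m.isLt

/-- Build `U_w`, then `U_v` given `W = U_w G_N`, then `U_x` given `V = U_v G_N`. -/
def layered {n : ℕ} (rule : ∀ (_ : Layer) (i : Fin (2 ^ n)), Ctx n i → Bit) : Layer → Word n :=
  let uw : Word n := seqBuild fun i p => rule .w i (0, p)
  let uv : Word n := seqBuild fun i p => rule .v i (polar uw, p)
  let ux : Word n := seqBuild fun i p => rule .x i (polar uv, p)
  fun
    | .w => uw
    | .v => uv
    | .x => ux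

section Coding

variable {Y : Rcv → Type*} {n k : ℕ}

/-- Message and frozen bits, placed in their slots. -/
noncomputable def placed (A : Alloc n) (M : Model Y) (β : ℝ) (m₀ : PubMsg A k) (m₁ : PrivMsg A k)
    (c : FrozenBits A M β k) (s : Slot k n) : Bit :=
  open Classical in
  if h : A.IsPublic s then m₀ ⟨s, h⟩
  else if h : A.IsPrivate s then m₁ ⟨s, h⟩
  else if h : A.IsFrozen M β s then c ⟨s, h⟩
  else 0

/-- The bits in the high-entropy slots, after copying from each block to the next one. -/
def filled (A : Alloc n) (F : Slot k n → Bit) (t : Fin k) (l : Layer) (i : Fin (2 ^ n)) : Bit :=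
  if 0 < t.val then
    match A.src l i with
    | some p => F (⟨t.val - 1, (Nat.sub_le _ _).trans_lt t.isLt⟩, p)
    | none => F (t, l, i)
  else F (t, l, i)

/-- The vectors `U_w, U_v, U_x` of block `t`. -/
noncomputable def encode (A : Alloc n) (M : Model Y) (β : ℝ) (m₀ : PubMsg A k) (m₁ : PrivMsg A k)
    (c : FrozenBits A M β k) (r : Shared k n) (t : Fin k) : Layer → Word n :=
  layered fun l i s =>
    if i ∈ M.setH n β l then filled A (placed A M β m₀ m₁ c) t l i
    else if i ∈ M.setL n β l then argmaxBit (M.encProb n l i s)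
    else r (t, l, i) s

/-! Decoders. -/

/-- Successive cancellation decoding of block `t` at receiver `j`. In the high-entropy positions,
`known` are the bits known from the neighbouring block, the other bits in `I_j` are found by
maximum likelihood, and the remaining ones (in `F_j`) are frozen bits shared with receiver `j`. -/
noncomputable def scDecode (A : Alloc n) (M : Model Y) (β : ℝ) (j : Rcv)
    (c : FrozenBits A M β k) (r : Shared k n) (t : Fin k)
    (known : Layer → Fin (2 ^ n) → Option Bit) (y : Fin (2 ^ n) → Y j) : Layer → Word n :=
  open Classical in
  layered fun l i s =>
    if i ∈ M.setH n β l then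
      match known l i with
      | some b => b
      | none =>
        if i ∈ M.setI n β j l then argmaxBit (M.decProb n j l i s y)
        else if h : A.IsFrozen M β (t, l, i) then c ⟨(t, l, i), h⟩
        else 0
    else if i ∈ M.setL n β l then argmaxBit (M.decProb n j l i s y)
    else r (t, l, i) s

/-- Process the blocks in increasing order, each given the result for the previous one. -/
def forwardPass {γ : Type*} (step : Fin k → Option γ → γ) (t : Fin k) : γ :=
  step t (if h : 0 < t.val then
    some (forwardPass step ⟨t.val - 1, (Nat.sub_le _ _).trans_lt t.isLt⟩) else none)
termination_by t.val
decreasing_by exact Nat.sub_lt h Nat.one_pos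

/-- Process the blocks in decreasing order, each given the result for the next one. -/
def backwardPass {γ : Type*} (step : Fin k → Option γ → γ) (t : Fin k) : γ :=
  step t (if h : t.val + 1 < k then some (backwardPass step ⟨t.val + 1, h⟩) else none)
termination_by k - t.val
decreasing_by exact Nat.sub_lt_sub_left t.isLt (Nat.lt_succ_self _)

/-- The decoded vectors of all blocks at receiver `j`: receiver 3 decodes the blocks in increasing
order, receivers 1 and 2 in decreasing order. A receiver which does not need a layer ignores it: the
layers are decoded one after the other, so the result in a layer is not affected by later layers
of the same block. -/
noncomputable def decodeBlocks (A : Alloc n) (M : Model Y) (β : ℝ) (j : Rcv)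
    (c : FrozenBits A M β k) (r : Shared k n) (y : Fin k → Fin (2 ^ n) → Y j) :
    Fin k → Layer → Word n :=
  match j with
  | .r3 => forwardPass fun t prev => scDecode A M β .r3 c r t
      (fun l i => prev.bind fun U => (A.src l i).map fun p => U p.1 p.2) (y t)
  | .r2 => backwardPass fun t next => scDecode A M β .r2 c r t
      (fun l i => next.bind fun U => (A.dst l i).map fun p => U p.1 p.2) (y t)
  | .r1 => backwardPass fun t next => scDecode A M β .r1 c r t
      (fun l i => next.bind fun U => (A.dst l i).map fun p => U p.1 p.2) (y t)

/-- The public message read off from decoded vectors. -/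
def readPub (A : Alloc n) (D : Fin k → Layer → Word n) : PubMsg A k :=
  fun s => D s.val.1 s.val.2.1 s.val.2.2

/-- The private message read off from decoded vectors. -/
def readPriv (A : Alloc n) (D : Fin k → Layer → Word n) : PrivMsg A k :=
  fun s => D s.val.1 s.val.2.1 s.val.2.2

/-- Channel outputs of all blocks at all receivers. -/
abbrev Outputs (Y : Rcv → Type*) (k n : ℕ) := Fin k → Fin (2 ^ n) → ∀ j, Y j

/-- Receiver 1 errs about `(M₀, M₁)`, or receiver 2 or receiver 3 errs about `M₀`. -/
def IsError (A : Alloc n) (M : Model Y) (β : ℝ) (c : FrozenBits A M β k)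
    (o : (PubMsg A k × PrivMsg A k) × Shared k n × Outputs Y k n) : Prop :=
  let D := fun j => decodeBlocks A M β j c o.2.1 fun t i => o.2.2 t i j
  (readPub A (D .r1), readPriv A (D .r1)) ≠ o.1 ∨ readPub A (D .r2) ≠ o.1.1 ∨
    readPub A (D .r3) ≠ o.1.1

/-! Probabilities. -/

/-- The law of the random code `ℂ`: independent fair frozen bits. -/
noncomputable def codeLaw (A : Alloc n) (M : Model Y) (β : ℝ) (k : ℕ) : PMF (FrozenBits A M β k) :=
  fairBits _

/-- Uniform independent messages `(M₀, M₁)`. -/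
noncomputable def msgLaw (A : Alloc n) (k : ℕ) : PMF (PubMsg A k × PrivMsg A k) :=
  (fairBits _).bind fun m₀ => (fairBits _).map fun m₁ => (m₀, m₁)

/-- The law of `(U_w, U_v, U_x)` of block `t` given `ℂ = c`. -/
noncomputable def blockLaw (A : Alloc n) (M : Model Y) (β : ℝ) (ρ : SharedRule M n β)
    (c : FrozenBits A M β k) (t : Fin k) : PMF (Layer → Word n) :=
  (msgLaw A k).bind fun m => (ρ.sharedLaw k).map fun r => encode A M β m.1 m.2 c r t

/-- The joint law of messages, common randomness and channel outputs given `ℂ = c`: the codewords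
`X = U_x G_N` of all blocks are sent over the memoryless channel. -/
noncomputable def transmissionLaw (A : Alloc n) (M : Model Y) (β : ℝ) (ρ : SharedRule M n β)
    (c : FrozenBits A M β k) :
    PMF ((PubMsg A k × PrivMsg A k) × Shared k n × Outputs Y k n) :=
  (msgLaw A k).bind fun m => (ρ.sharedLaw k).bind fun r =>
    (pmfPi fun t : Fin k => pmfPi fun i : Fin (2 ^ n) =>
      M.chan (polar (encode A M β m.1 m.2 c r t .x) i)).map fun y => (m, r, y)

/-- The error probability `P_e(c)` of the code `c`. -/
noncomputable def errorProb (A : Alloc n) (M : Model Y) (β : ℝ) (ρ : SharedRule M n β)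
    (c : FrozenBits A M β k) : ℝ≥0∞ :=
  (transmissionLaw A M β ρ c).toOuterMeasure {o | IsError A M β c o}

end Coding

end PolarBC

open PolarBC

/-!
No polarization theorem is needed: the statement holds for whatever index sets the thresholds
`δ_n` and `1 - δ_n` happen to produce, because it compares two laws position by position.

**Law of a block.** Within one block the high-entropy positions read distinct message or frozen
bits: a copy target reads a message bit of the previous block, every other position its own bit
(`Alloc.Sound.sourceSlot_injective`). Averaged over the code these bits are therefore independent
and fair, the common randomness has the true conditional laws as marginals, and the law of
`(U_w, U_v, U_x)` is a product of kernels, which is `Q` (`expect_blockLaw_apply`).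

**Distance from the i.i.d. law.** By the chain rule, by the Markov property `W → V → X`, and because
the polar transform is an involution (`polar_polar`), the i.i.d. law of `(U_w, U_v, U_x)` is the
product of the true conditional laws (`map_uOf_eq_kernelProd`). Replacing one kernel at a time
(`sum_kernelProd_le`) changes the mean of a function bounded by one at most by the sum over the
positions of the mean distances of the kernels. For a position with `Z ≥ 1 - δ` the conditional law
is within `√δ` of uniform in the mean (`expect_half_tsub_condBit_le`); for one with `Z ≤ δ` it is
within `δ` of the point mass at its mode (`expect_mode_tsub_condBit_le`). The total is at most
`3 N √δ_n`.

**Decoding.** Call a block decodable if, given the true past, all argmax decisions of all receivers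
at the positions of `I_j` and of the low-entropy set are right. Under the i.i.d. law a decision errs
with probability at most its Bhattacharyya parameter (`expect_argmaxBit_ne_le`), and conditioning on
the output can only decrease that parameter (`bhatt_le_of_degraded`), so a block fails to be
decodable with probability at most `9 N δ_n`, and under `Q` with probability at most `12 N √δ_n`
(`sum_Q_mul_not_decodable_le`). If all blocks are decodable, no receiver errs: the bits taken from
the neighbouring block are right by induction along the decoding order, and all positions outside
`I_j` that are not known in this way are frozen (`not_isError_of_decodable`). Receiver 1 relies on
`I_2^w ⊆ I_1^w`, which holds because `Y₂` is a degraded version of `Y₁`; receiver 2 obtains the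
public bits of layer `v` from their copies in layer `w`.

A union bound over the `k` blocks gives `12 k N 2 ^ (- N ^ β / 2)`, and any exponent `β' < β` absorbs
the polynomial factor and the factor `1 / 2`.
-/

namespace PolarBC

/-! ### Expectations and product laws -/

/-- The indicator of a proposition, as an extended nonnegative real. -/
noncomputable def ind (p : Prop) : ℝ≥0∞ :=
  open Classical in if p then 1 else 0

theorem ind_pos {p : Prop} (h : p) : ind p = 1 := if_pos h

theorem ind_neg {p : Prop} (h : ¬p) : ind p = 0 := if_neg h

theorem ind_eq_ite (p : Prop) [Decidable p] : ind p = if p then 1 else 0 := by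
  unfold ind; congr

theorem ind_le_one (p : Prop) : ind p ≤ 1 := by
  by_cases h : p
  · rw [ind_pos h]
  · rw [ind_neg h]; exact zero_le_one

theorem ind_mono {p q : Prop} (h : p → q) : ind p ≤ ind q := by
  by_cases hp : p
  · rw [ind_pos hp, ind_pos (h hp)]
  · rw [ind_neg hp]; exact zero_le

theorem ind_and (p q : Prop) : ind (p ∧ q) = ind p * ind q := by
  by_cases hp : p <;> by_cases hq : q <;> simp [ind, hp, hq]

theorem ind_forall {ι : Type*} [Fintype ι] (p : ι → Prop) : ind (∀ i, p i) = ∏ i, ind (p i) := by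
  by_cases h : ∀ i, p i
  · rw [ind_pos h, Finset.prod_eq_one fun i _ => ind_pos (h i)]
  · rw [ind_neg h]
    push Not at h
    obtain ⟨i, hi⟩ := h
    exact (Finset.prod_eq_zero (Finset.mem_univ i) (ind_neg hi)).symm

theorem ind_exists_le {ι : Type*} [Fintype ι] (p : ι → Prop) :
    ind (∃ i, p i) ≤ ∑ i, ind (p i) := by
  by_cases h : ∃ i, p i
  · obtain ⟨i, hi⟩ := h
    calc ind (∃ i, p i) ≤ ind (p i) := by rw [ind_pos hi]; exact ind_le_one _
      _ ≤ _ := Finset.single_le_sum (f := fun i => ind (p i)) (fun _ _ => zero_le)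
        (Finset.mem_univ i)
  · rw [ind_neg h]; exact zero_le

theorem tsum_ind_mul {α : Type*} (a : α) (f : α → ℝ≥0∞) : ∑' b, ind (a = b) * f b = f a := by
  rw [tsum_eq_single a fun b hb => by rw [ind_neg (Ne.symm hb), zero_mul], ind_pos rfl, one_mul]

section Expect

variable {α β : Type*}

theorem expect_fintype [Fintype α] (p : PMF α) (f : α → ℝ≥0∞) :
    expect p f = ∑ a, p a * f a := tsum_fintype _

theorem expect_pure (a : α) (f : α → ℝ≥0∞) : expect (PMF.pure a) f = f a := by
  unfold expect
  rw [tsum_eq_single a fun b hb => by simp [hb]]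
  simp

theorem expect_bind (p : PMF α) (q : α → PMF β) (f : β → ℝ≥0∞) :
    expect (p.bind q) f = expect p fun a => expect (q a) f := by
  unfold expect
  simp_rw [PMF.bind_apply, ← ENNReal.tsum_mul_right, ← ENNReal.tsum_mul_left]
  rw [ENNReal.tsum_comm]
  simp_rw [mul_assoc]

theorem expect_map (p : PMF α) (g : α → β) (f : β → ℝ≥0∞) :
    expect (p.map g) f = expect p fun a => f (g a) := by
  rw [← PMF.bind_pure_comp, expect_bind]
  simp [expect_pure]

theorem expect_mono (p : PMF α) {f g : α → ℝ≥0∞} (h : ∀ a, f a ≤ g a) :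
    expect p f ≤ expect p g :=
  ENNReal.tsum_le_tsum fun a => mul_le_mul_right (h a) _

theorem expect_const (p : PMF α) (c : ℝ≥0∞) : expect p (fun _ => c) = c := by
  unfold expect
  rw [ENNReal.tsum_mul_right, p.tsum_coe, one_mul]

theorem expect_le_one (p : PMF α) {f : α → ℝ≥0∞} (h : ∀ a, f a ≤ 1) : expect p f ≤ 1 :=
  (expect_mono p h).trans_eq (expect_const p 1)

theorem expect_add (p : PMF α) (f g : α → ℝ≥0∞) :
    expect p (fun a => f a + g a) = expect p f + expect p g := by
  unfold expect
  simp_rw [mul_add]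
  exact ENNReal.tsum_add

theorem expect_mul_left (p : PMF α) (c : ℝ≥0∞) (f : α → ℝ≥0∞) :
    expect p (fun a => c * f a) = c * expect p f := by
  unfold expect
  simp_rw [mul_left_comm _ c, ENNReal.tsum_mul_left]

theorem expect_mul_right (p : PMF α) (c : ℝ≥0∞) (f : α → ℝ≥0∞) :
    expect p (fun a => f a * c) = expect p f * c := by
  simp_rw [mul_comm _ c, expect_mul_left]

theorem expect_tsum {ι : Type*} (p : PMF α) (f : ι → α → ℝ≥0∞) :
    expect p (fun a => ∑' i, f i a) = ∑' i, expect p (f i) := by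
  unfold expect
  simp_rw [← ENNReal.tsum_mul_left]
  exact ENNReal.tsum_comm

theorem expect_sum {ι : Type*} [Fintype ι] (p : PMF α) (f : ι → α → ℝ≥0∞) :
    expect p (fun a => ∑ i, f i a) = ∑ i, expect p (f i) := by
  simp_rw [← tsum_fintype (L := SummationFilter.unconditional _)]
  exact expect_tsum p f

theorem map_eq_expect (p : PMF α) (g : α → β) (b : β) :
    p.map g b = expect p fun a => ind (g a = b) := by
  rw [PMF.map_apply]
  refine tsum_congr fun a => ?_
  dsimp only
  by_cases h : b = g a
  · rw [if_pos h, ind_pos h.symm, mul_one]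
  · rw [if_neg h, ind_neg (Ne.symm h), mul_zero]

theorem apply_eq_expect (p : PMF α) (b : α) : p b = expect p fun a => ind (a = b) := by
  conv_lhs => rw [← PMF.map_id p]
  exact map_eq_expect p id b

theorem toOuterMeasure_eq_expect (p : PMF α) (s : Set α) :
    p.toOuterMeasure s = expect p fun a => ind (a ∈ s) := by
  rw [PMF.toOuterMeasure_apply]
  refine tsum_congr fun a => ?_
  dsimp only
  by_cases h : a ∈ s
  · rw [Set.indicator_of_mem h, ind_pos h, mul_one]
  · rw [Set.indicator_of_notMem h, ind_neg h, mul_zero]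

end Expect

section Pi

theorem tsum_prod_pi_fin : ∀ (n : ℕ) {α : Fin n → Type*} (f : ∀ i, α i → ℝ≥0∞),
    ∑' a : (∀ i, α i), ∏ i, f i (a i) = ∏ i, ∑' a, f i a
  | 0, α, f => by
      rw [tsum_eq_single (fun i => i.elim0 : ∀ i, α i)
        (fun b hb => absurd (Subsingleton.elim _ _) hb)]
      simp
  | n + 1, α, f => by
      rw [← (Fin.consEquiv α).tsum_eq, ENNReal.tsum_prod']
      have h2 := tsum_prod_pi_fin n (fun i => f i.succ)
      simp only [Fin.consEquiv_apply, Fin.prod_univ_succ, Fin.cons_zero, Fin.cons_succ]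
      simp_rw [ENNReal.tsum_mul_left, h2, ENNReal.tsum_mul_right]

theorem tsum_prod_pi {ι : Type*} [Fintype ι] {α : ι → Type*} (f : ∀ i, α i → ℝ≥0∞) :
    ∑' a : (∀ i, α i), ∏ i, f i (a i) = ∏ i, ∑' a, f i a := by
  classical
  let e := (Fintype.equivFin ι).symm
  rw [← (Equiv.piCongrLeft α e).tsum_eq, ← e.prod_comp]
  rw [← tsum_prod_pi_fin (Fintype.card ι) (fun i => f (e i))]
  refine tsum_congr fun a => ?_
  rw [← e.prod_comp]
  refine Finset.prod_congr rfl fun i _ => ?_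
  rw [Equiv.piCongrLeft_apply_apply]

variable {ι : Type*} [Fintype ι] {α β : ι → Type*}

theorem pmfPi_apply (p : ∀ i, PMF (α i)) (a : ∀ i, α i) : pmfPi p a = ∏ i, p i (a i) := rfl

theorem expect_pmfPi_prod (p : ∀ i, PMF (α i)) (f : ∀ i, α i → ℝ≥0∞) :
    expect (pmfPi p) (fun a => ∏ i, f i (a i)) = ∏ i, expect (p i) (f i) := by
  unfold expect
  simp_rw [pmfPi_apply, ← Finset.prod_mul_distrib]
  exact tsum_prod_pi fun i a => p i a * f i a

theorem pmfPi_bind (p : ∀ i, PMF (α i)) (q : ∀ i, α i → PMF (β i)) :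
    pmfPi (fun i => (p i).bind (q i)) = (pmfPi p).bind fun a => pmfPi fun i => q i (a i) := by
  ext b
  simp_rw [PMF.bind_apply, pmfPi_apply, PMF.bind_apply, ← Finset.prod_mul_distrib]
  exact (tsum_prod_pi fun i a => p i a * q i a (b i)).symm

theorem pmfPi_pure (a : ∀ i, α i) : pmfPi (fun i => PMF.pure (a i)) = PMF.pure a := by
  classical
  ext b
  rw [pmfPi_apply, PMF.pure_apply]
  split_ifs with h
  · subst h; simp
  · obtain ⟨i, hi⟩ := Function.ne_iff.1 h
    exact Finset.prod_eq_zero (Finset.mem_univ i) (by simp [hi])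

theorem pmfPi_map (p : ∀ i, PMF (α i)) (g : ∀ i, α i → β i) :
    pmfPi (fun i => (p i).map (g i)) = (pmfPi p).map fun a i => g i (a i) := by
  simp_rw [← PMF.bind_pure_comp, pmfPi_bind, Function.comp_def, pmfPi_pure]

theorem expect_pmfPi_eval (p : ∀ i, PMF (α i)) (i : ι) (f : α i → ℝ≥0∞) :
    expect (pmfPi p) (fun a => f (a i)) = expect (p i) f := by
  classical
  have h := expect_pmfPi_prod p (Function.update (fun j _ => (1 : ℝ≥0∞)) i f)
  rw [Finset.prod_eq_single i (fun j _ hj => by simp [hj, expect_const]) (by simp)] at h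
  rw [Function.update_self] at h
  rw [← h]
  congr 1
  funext a
  rw [Finset.prod_eq_single i (fun j _ hj => by simp [hj]) (by simp), Function.update_self]

end Pi

/-! ### Conditional probabilities of a bit and Bhattacharyya parameters -/

theorem sum_bit {R : Type*} [AddCommMonoid R] (f : Bit → R) : ∑ b, f b = f 0 + f 1 :=
  Fin.sum_univ_two f

section Bhatt

variable {Ω σ : Type*} (P : PMF Ω) (B : Ω → Bit) (S : Ω → σ)

theorem map_fst_eq_sum (s : σ) : P.map S s = ∑ b, P.map (fun o => (S o, B o)) (s, b) := by
  simp_rw [map_eq_expect, ← expect_sum]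
  congr 1
  funext o
  simp_rw [Prod.mk.injEq, ind_and, ← Finset.mul_sum]
  rw [Finset.sum_eq_single (B o) (fun b _ hb => ind_neg (Ne.symm hb)) (by simp), ind_pos rfl,
    mul_one]

theorem map_mul_condBit (s : σ) (b : Bit) :
    P.map S s * condBit P B S s b = P.map (fun o => (S o, B o)) (s, b) := by
  unfold condBit
  split_ifs with h
  · rw [h, zero_mul]
    rw [map_fst_eq_sum P B S, Finset.sum_eq_zero_iff] at h
    exact (h b (Finset.mem_univ b)).symm
  · exact ENNReal.mul_div_cancel h (PMF.apply_ne_top _ _)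

theorem sum_condBit (s : σ) : ∑ b, condBit P B S s b = 1 := by
  by_cases h : P.map S s = 0
  · simpa [condBit, h] using ENNReal.mul_inv_cancel (by norm_num) (by norm_num)
  · have h1 : P.map S s * ∑ b, condBit P B S s b = P.map S s * 1 := by
      rw [Finset.mul_sum, mul_one]
      simp_rw [map_mul_condBit]
      exact (map_fst_eq_sum P B S s).symm
    exact (ENNReal.mul_right_inj h (PMF.apply_ne_top _ _)).1 h1

/-- The tower property. -/
theorem expect_eq_expect_condBit (g : σ → Bit → ℝ≥0∞) :
    expect P (fun o => g (S o) (B o)) =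
      expect P fun o => ∑ b, condBit P B S (S o) b * g (S o) b := by
  rw [← expect_map P (fun o => (S o, B o)) fun q => g q.1 q.2,
    ← expect_map P S fun s => ∑ b, condBit P B S s b * g s b]
  unfold expect
  rw [ENNReal.tsum_prod']
  refine tsum_congr fun s => ?_
  rw [tsum_fintype, Finset.mul_sum]
  refine Finset.sum_congr rfl fun b _ => ?_
  rw [← map_mul_condBit, mul_assoc]

theorem bhatt_eq_expect :
    bhatt P B S =
      2 * expect P fun o => (condBit P B S (S o) 1 * condBit P B S (S o) 0) ^ (1 / 2 : ℝ) := by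
  rw [← expect_map P S fun s => (condBit P B S s 1 * condBit P B S s 0) ^ (1 / 2 : ℝ)]
  rfl

theorem mul_self_rpow_half (x : ℝ≥0∞) : (x * x) ^ (1 / 2 : ℝ) = x := by
  rw [← sq, ← ENNReal.rpow_natCast, ← ENNReal.rpow_mul]
  norm_num

theorem bhatt_eq_tsum_joint :
    bhatt P B S = 2 * ∑' s, (P.map (fun o => (S o, B o)) (s, 1) *
      P.map (fun o => (S o, B o)) (s, 0)) ^ (1 / 2 : ℝ) := by
  unfold bhatt
  congr 1
  refine tsum_congr fun s => ?_
  rw [← map_mul_condBit, ← map_mul_condBit, mul_mul_mul_comm,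
    ENNReal.mul_rpow_of_nonneg (P.map S s * P.map S s) _ (by norm_num), mul_self_rpow_half]

/-- The Cauchy–Schwarz inequality for series. -/
theorem tsum_rpow_half_mul_le {ι : Type*} (f g : ι → ℝ≥0∞) :
    ∑' i, (f i * g i) ^ (1 / 2 : ℝ) ≤ ((∑' i, f i) * ∑' i, g i) ^ (1 / 2 : ℝ) := by
  rw [ENNReal.tsum_eq_iSup_sum]
  refine iSup_le fun s => ?_
  have h := ENNReal.inner_le_Lp_mul_Lq s (fun i => f i ^ (1 / 2 : ℝ)) (fun i => g i ^ (1 / 2 : ℝ))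
    Real.HolderConjugate.two_two
  simp_rw [← ENNReal.rpow_mul] at h
  norm_num at h
  simp_rw [ENNReal.mul_rpow_of_nonneg _ _ (show (0 : ℝ) ≤ 1 / 2 by norm_num)]
  norm_num
  exact h.trans (mul_le_mul' (ENNReal.rpow_le_rpow (ENNReal.sum_le_tsum s) (by norm_num))
    (ENNReal.rpow_le_rpow (ENNReal.sum_le_tsum s) (by norm_num)))

/-- Degrading the observation `S` through a stochastic kernel `K` increases the Bhattacharyya
parameter. -/
theorem bhatt_le_of_degraded {τ : Type*} (T : Ω → τ) (K : σ → τ → ℝ≥0∞)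
    (hK : ∀ s, ∑' t, K s t = 1)
    (h : ∀ t b, P.map (fun o => (T o, B o)) (t, b) =
      ∑' s, P.map (fun o => (S o, B o)) (s, b) * K s t) :
    bhatt P B S ≤ bhatt P B T := by
  rw [bhatt_eq_tsum_joint, bhatt_eq_tsum_joint]
  refine mul_le_mul_right ?_ 2
  calc ∑' s, (P.map (fun o => (S o, B o)) (s, 1) *
        P.map (fun o => (S o, B o)) (s, 0)) ^ (1 / 2 : ℝ)
      = ∑' s, ∑' t, (P.map (fun o => (S o, B o)) (s, 1) * K s t *
        (P.map (fun o => (S o, B o)) (s, 0) * K s t)) ^ (1 / 2 : ℝ) := by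
        refine tsum_congr fun s => ?_
        simp_rw [mul_mul_mul_comm _ (K s _), ENNReal.mul_rpow_of_nonneg _ (K s _ * K s _)
          (show (0 : ℝ) ≤ 1 / 2 by norm_num), mul_self_rpow_half]
        rw [ENNReal.tsum_mul_left, hK, mul_one]
    _ = ∑' t, ∑' s, (P.map (fun o => (S o, B o)) (s, 1) * K s t *
        (P.map (fun o => (S o, B o)) (s, 0) * K s t)) ^ (1 / 2 : ℝ) := ENNReal.tsum_comm
    _ ≤ _ := by
        refine ENNReal.tsum_le_tsum fun t => ?_
        rw [h, h]
        exact tsum_rpow_half_mul_le _ _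

theorem tsum_joint_mul (b : Bit) (g : σ → ℝ≥0∞) :
    ∑' s, P.map (fun o => (S o, B o)) (s, b) * g s =
      expect P fun o => g (S o) * ind (B o = b) := by
  rw [← expect_map P (fun o => (S o, B o)) fun q => g q.1 * ind (q.2 = b)]
  unfold expect
  rw [ENNReal.tsum_prod']
  refine tsum_congr fun s => ?_
  dsimp only
  rw [tsum_eq_single b fun b' hb' => by rw [ind_neg hb', mul_zero, mul_zero],
    ind_pos (p := b = b) rfl, mul_one]

theorem bhatt_prodMk_le {τ : Type*} (T : Ω → τ) :
    bhatt P B (fun o => (S o, T o)) ≤ bhatt P B S := by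
  refine bhatt_le_of_degraded P B _ S (fun q t => ind (q.1 = t)) (fun q => ?_) fun s b => ?_
  · simpa using tsum_ind_mul q.1 fun _ => 1
  · rw [map_eq_expect, tsum_joint_mul]
    simp_rw [Prod.mk.injEq, ind_and]

theorem min_le_rpow_half {a c : ℝ≥0∞} (h : a ≤ c) : a ≤ (a * c) ^ (1 / 2 : ℝ) := by
  conv_lhs => rw [← mul_self_rpow_half a]
  exact ENNReal.rpow_le_rpow (mul_le_mul_right h a) (by norm_num)

theorem sum_mul_ind_argmaxBit_ne_le (c : Bit → ℝ≥0∞) :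
    ∑ b, c b * ind (argmaxBit c ≠ b) ≤ (c 1 * c 0) ^ (1 / 2 : ℝ) := by
  rw [sum_bit]
  by_cases h : c 1 ≤ c 0
  · have h0 : argmaxBit c = 0 := if_pos h
    rw [h0, ind_neg (by simp), ind_pos (by decide), mul_zero, zero_add, mul_one]
    exact min_le_rpow_half h
  · have h0 : argmaxBit c = 1 := if_neg h
    rw [h0, ind_neg (p := (1 : Bit) ≠ 1) (by simp), ind_pos (by decide), mul_zero, add_zero,
      mul_one, mul_comm]
    exact min_le_rpow_half (le_of_not_ge h)

theorem sum_ind_argmaxBit_tsub_le (c : Bit → ℝ≥0∞) (hc : ∑ b, c b = 1) :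
    ∑ b, (ind (b = argmaxBit c) - c b) ≤ (c 1 * c 0) ^ (1 / 2 : ℝ) := by
  rw [sum_bit] at hc ⊢
  by_cases h : c 1 ≤ c 0
  · have h0 : argmaxBit c = 0 := if_pos h
    rw [h0, ind_pos rfl, ind_neg (by decide), zero_tsub, add_zero]
    refine le_trans (tsub_le_iff_left.2 hc.ge) (min_le_rpow_half h)
  · have h0 : argmaxBit c = 1 := if_neg h
    rw [h0, ind_pos rfl, ind_neg (by decide), zero_tsub, zero_add, mul_comm]
    refine le_trans (tsub_le_iff_right.2 hc.ge) (min_le_rpow_half (le_of_not_ge h))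

/-- The error probability of the maximum a posteriori rule is at most the Bhattacharyya
parameter. -/
theorem expect_argmaxBit_ne_le :
    expect P (fun o => ind (argmaxBit (condBit P B S (S o)) ≠ B o)) ≤ bhatt P B S := by
  rw [expect_eq_expect_condBit P B S fun s b => ind (argmaxBit (condBit P B S s) ≠ b),
    bhatt_eq_expect]
  refine (expect_mono P fun o => sum_mul_ind_argmaxBit_ne_le _).trans ?_
  exact le_mul_of_one_le_left zero_le one_le_two

/-- The mean distance between the conditional law of `B` and the point mass at its mode. -/
theorem expect_mode_tsub_condBit_le :
    expect P (fun o => ∑ b, (ind (b = argmaxBit (condBit P B S (S o))) - condBit P B S (S o) b)) ≤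
      bhatt P B S := by
  rw [bhatt_eq_expect]
  refine (expect_mono P fun o => sum_ind_argmaxBit_tsub_le _ (sum_condBit P B S _)).trans ?_
  exact le_mul_of_one_le_left zero_le one_le_two

/-- For a bit with probabilities `x` and `1 - x` the squared distance from the fair bit is
`(1 - z ^ 2) / 4`, where `z = 2 √(x (1 - x))`; the arithmetic-geometric mean inequality with weight
`η` makes the estimate affine in `z`, so that it can be averaged. -/
theorem abs_half_sub_add_sqrt_le {x η : ℝ} (h0 : 0 ≤ x) (h1 : x ≤ 1) (hη : 0 < η) :
    |x - 1 / 2| + 1 / (4 * η) * (2 * √((1 - x) * x)) ≤ η / 2 + 1 / (4 * η) := by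
  set z := 2 * √((1 - x) * x) with hz
  have hz0 : 0 ≤ z := by positivity
  have hz2 : z ^ 2 = 4 * ((1 - x) * x) := by
    rw [hz, mul_pow, Real.sq_sqrt (mul_nonneg (by linarith) h0)]; norm_num
  have hz1 : z ≤ 1 := by nlinarith [sq_nonneg (2 * x - 1)]
  have hd : |x - 1 / 2| ^ 2 = (1 - z ^ 2) / 4 := by rw [sq_abs, hz2]; ring
  have key : 4 * η * |x - 1 / 2| + z ≤ 2 * η ^ 2 + 1 := by
    nlinarith [sq_nonneg (|x - 1 / 2| - η)]
  have e : η / 2 + 1 / (4 * η) - (|x - 1 / 2| + 1 / (4 * η) * z) =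
      (2 * η ^ 2 + 1 - (4 * η * |x - 1 / 2| + z)) / (4 * η) := by
    field_simp; ring
  have : 0 ≤ (2 * η ^ 2 + 1 - (4 * η * |x - 1 / 2| + z)) / (4 * η) :=
    div_nonneg (by linarith) (by positivity)
  linarith

theorem sum_half_tsub_add_le (c : Bit → ℝ≥0∞) (hc : ∑ b, c b = 1) {η : ℝ} (hη : 0 < η) :
    ∑ b, (2⁻¹ - c b) + ENNReal.ofReal (1 / (4 * η)) * (2 * (c 1 * c 0) ^ (1 / 2 : ℝ)) ≤
      ENNReal.ofReal (η / 2 + 1 / (4 * η)) := by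
  rw [sum_bit] at hc ⊢
  have hle : c 0 ≤ 1 := hc ▸ le_self_add
  have ht : c 0 ≠ ∞ := ne_top_of_le_ne_top ENNReal.one_ne_top hle
  obtain ⟨x, hx0, hx⟩ : ∃ x : ℝ, 0 ≤ x ∧ c 0 = ENNReal.ofReal x :=
    ⟨(c 0).toReal, ENNReal.toReal_nonneg, (ENNReal.ofReal_toReal ht).symm⟩
  have hx1 : x ≤ 1 := by rw [hx] at hle; exact ENNReal.ofReal_le_one.1 hle
  have hc1 : c 1 = ENNReal.ofReal (1 - x) := by
    rw [ENNReal.ofReal_sub _ hx0, ENNReal.ofReal_one, ← hx]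
    exact ENNReal.eq_sub_of_add_eq ht (by rw [add_comm]; exact hc)
  have hh : (2⁻¹ : ℝ≥0∞) = ENNReal.ofReal (1 / 2) := by
    rw [one_div, ENNReal.ofReal_inv_of_pos two_pos]; norm_num
  have h2 : (2 : ℝ≥0∞) = ENNReal.ofReal 2 := by norm_num
  have habs : (2⁻¹ - c 0) + (2⁻¹ - c 1) = ENNReal.ofReal |x - 1 / 2| := by
    rw [hh, hx, hc1, ← ENNReal.ofReal_sub _ hx0, ← ENNReal.ofReal_sub _ (by linarith)]
    rcases le_total x (1 / 2) with h | h
    · rw [ENNReal.ofReal_of_nonpos (p := 1 / 2 - (1 - x)) (by linarith), add_zero,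
        abs_of_nonpos (by linarith)]
      congr 1; ring
    · rw [ENNReal.ofReal_of_nonpos (p := 1 / 2 - x) (by linarith), zero_add,
        abs_of_nonneg (by linarith)]
      congr 1; ring
  rw [habs, hc1, hx, ← ENNReal.ofReal_mul (by linarith),
    ENNReal.ofReal_rpow_of_nonneg (mul_nonneg (by linarith) hx0) (by norm_num),
    ← Real.sqrt_eq_rpow, h2, ← ENNReal.ofReal_mul two_pos.le, ← ENNReal.ofReal_mul (by positivity),
    ← ENNReal.ofReal_add (abs_nonneg _) (by positivity)]
  exact ENNReal.ofReal_le_ofReal (abs_half_sub_add_sqrt_le hx0 hx1 hη)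

/-- A bit whose Bhattacharyya parameter is at least `1 - η ^ 2` is conditionally uniform up to a
mean distance `η`. -/
theorem expect_half_tsub_condBit_le {η : ℝ} (hη : 0 < η) (hη1 : η ≤ 1)
    (h : ENNReal.ofReal (1 - η ^ 2) ≤ bhatt P B S) :
    expect P (fun o => ∑ b, (2⁻¹ - condBit P B S (S o) b)) ≤ ENNReal.ofReal η := by
  have h1 := expect_mono P fun o =>
    sum_half_tsub_add_le (condBit P B S (S o)) (sum_condBit P B S _) hη
  rw [expect_const, expect_add, expect_mul_left, expect_mul_left, ← bhatt_eq_expect] at h1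
  have hsq : 0 ≤ 1 - η ^ 2 := by nlinarith
  have e : ENNReal.ofReal (η / 2 + 1 / (4 * η)) =
      ENNReal.ofReal (3 * η / 4) + ENNReal.ofReal (1 / (4 * η)) * ENNReal.ofReal (1 - η ^ 2) := by
    rw [← ENNReal.ofReal_mul (by positivity), ← ENNReal.ofReal_add (by positivity)
      (mul_nonneg (by positivity) hsq)]
    congr 1
    field_simp; ring
  have h2 := (add_le_add_right (mul_le_mul_right h (ENNReal.ofReal (1 / (4 * η)))) _).trans h1
  rw [e] at h2
  have h3 := ENNReal.le_of_add_le_add_right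
    (ENNReal.mul_ne_top ENNReal.ofReal_ne_top ENNReal.ofReal_ne_top) h2
  exact h3.trans (ENNReal.ofReal_le_ofReal (by linarith))

end Bhatt

/-! ### The polar transform is an involution -/

/-- Binary digit `a` of a position, as an index of the kernel. -/
def digit {n : ℕ} (k : Fin (2 ^ n)) (a : Fin n) : Fin 2 := finFunctionFinEquiv.symm k a

theorem ite_testBit_eq_digit {n : ℕ} (k : Fin (2 ^ n)) (a : Fin n) :
    (if k.val.testBit a.val then 1 else 0 : Fin 2) = digit k a := by
  apply Fin.ext
  rw [digit, finFunctionFinEquiv_symm_apply_val, Nat.testBit_eq_decide_div_mod_eq]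
  by_cases h : k.val / 2 ^ a.val % 2 = 1
  · simp [h]
  · simp [h]; omega

theorem polarG_eq_prod_digit {n : ℕ} (i j : Fin (2 ^ n)) :
    polarG n i j =
      ∏ a, (!![1, 0; 1, 1] : Matrix (Fin 2) (Fin 2) Bit) (digit i a.rev) (digit j a) := by
  unfold polarG
  refine Finset.prod_congr rfl fun a _ => ?_
  rw [← ite_testBit_eq_digit, ← ite_testBit_eq_digit, Fin.val_rev, Nat.sub_sub, Nat.add_comm 1]

theorem polarG_mul_self (n : ℕ) : polarG n * polarG n = 1 := by
  ext i j
  rw [Matrix.mul_apply]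
  set F : Matrix (Fin 2) (Fin 2) Bit := !![1, 0; 1, 1] with hF
  have hFF : F * F = 1 := by decide
  have h1 : ∀ k, polarG n i k * polarG n k j =
      ∏ a, F (digit i a.rev) (digit k a) * F (digit k a) (digit j a.rev) := by
    intro k
    rw [polarG_eq_prod_digit, polarG_eq_prod_digit, ← Equiv.prod_comp Fin.revPerm (fun a =>
      F (digit k a.rev) (digit j a)), ← Finset.prod_mul_distrib]
    simp only [Fin.revPerm_apply, Fin.rev_rev, hF]
  simp_rw [h1]
  have h2 := (finFunctionFinEquiv (m := 2) (n := n)).symm.sum_comp fun κ : Fin n → Fin 2 =>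
    ∏ a, F (digit i a.rev) (κ a) * F (κ a) (digit j a.rev)
  refine h2.trans ?_
  have h3 := Finset.prod_univ_sum (fun _ : Fin n => (Finset.univ : Finset (Fin 2)))
    fun a x => F (digit i a.rev) x * F x (digit j a.rev)
  rw [Fintype.piFinset_univ] at h3
  rw [← h3]
  simp_rw [← Matrix.mul_apply, hFF]
  by_cases hij : i = j
  · subst hij; simp
  · rw [Matrix.one_apply_ne hij]
    have : digit i ≠ digit j := fun h => hij (finFunctionFinEquiv.symm.injective h)
    obtain ⟨a, ha⟩ := Function.ne_iff.1 this
    refine Finset.prod_eq_zero (Finset.mem_univ a.rev) ?_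
    rw [Fin.rev_rev]
    exact Matrix.one_apply_ne ha

theorem polar_polar {n : ℕ} (u : Word n) : polar (polar u) = u := by
  unfold polar
  rw [Matrix.vecMul_vecMul, polarG_mul_self, Matrix.vecMul_one]

/-! ### The i.i.d. source and its chain rule -/

theorem prod_layer {R : Type*} [CommMonoid R] (f : Layer → R) :
    ∏ l, f l = f .w * (f .v * f .x) := by
  change ∏ l ∈ {Layer.w, Layer.v, Layer.x}, f l = _
  rw [Finset.prod_insert (by decide), Finset.prod_insert (by decide), Finset.prod_singleton]

theorem sum_layer {R : Type*} [AddCommMonoid R] (f : Layer → R) :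
    ∑ l, f l = f .w + (f .v + f .x) := by
  change ∑ l ∈ {Layer.w, Layer.v, Layer.x}, f l = _
  rw [Finset.sum_insert (by decide), Finset.sum_insert (by decide), Finset.sum_singleton]

/-- The context of position `i` in layer `l`, as a function of the vectors `U_w, U_v, U_x`. -/
def ctxAt {n : ℕ} (u : Layer → Word n) (l : Layer) (i : Fin (2 ^ n)) : Ctx n i :=
  (parent (fun l' => polar (u l')) l, past (u l) i)

/-- The weight of `(U_w, U_v, U_x)` when each bit is drawn from the kernel `κ` given its context. -/
noncomputable def kernelProd {n : ℕ} (κ : ∀ (_ : Layer) (i : Fin (2 ^ n)), Ctx n i → Bit → ℝ≥0∞)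
    (u : Layer → Word n) : ℝ≥0∞ :=
  ∏ l, ∏ i, κ l i (ctxAt u l i) (u l i)

/-- The family with given values in the layers `w`, `v`, `x`. -/
def letters {α : Type*} (w v x : α) : Layer → α
  | .w => w
  | .v => v
  | .x => x

section ChainRule

variable {Ω σ : Type*} (P : PMF Ω) (S : Ω → σ) {n : ℕ} (U : Ω → Word n)

/-- One step of the chain rule: the events compare the words on the first `i` bits. -/
theorem expect_agree_succ (s : σ) (u : Word n) (i : Fin (2 ^ n)) :
    expect P (fun o => ind (S o = s ∧ ∀ j : Fin (2 ^ n), j.val < i.val + 1 → U o j = u j)) =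
      expect P (fun o => ind (S o = s ∧ ∀ j : Fin (2 ^ n), j.val < i.val → U o j = u j)) *
        condBit P (fun o => U o i) (fun o => (S o, past (U o) i)) (s, past u i) (u i) := by
  have hpast : ∀ o, past (U o) i = past u i ↔ ∀ j : Fin (2 ^ n), j.val < i.val → U o j = u j :=
    fun o => ⟨fun h j hj => congrFun h ⟨j.val, hj⟩, fun h => funext fun m => h _ m.isLt⟩
  have h := map_mul_condBit P (fun o => U o i) (fun o => (S o, past (U o) i)) (s, past u i) (u i)
  rw [map_eq_expect, map_eq_expect] at h
  simp_rw [Prod.mk.injEq, hpast] at h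
  rw [h]
  congr 1
  funext o
  congr 1
  refine propext ⟨fun ⟨h1, h2⟩ => ⟨⟨h1, fun j hj => h2 j (by omega)⟩, h2 i (by omega)⟩,
    fun ⟨⟨h1, h2⟩, h3⟩ => ⟨h1, fun j hj => ?_⟩⟩
  rcases Nat.lt_succ_iff_lt_or_eq.1 hj with h | h
  · exact h2 j h
  · rw [Fin.ext h, h3]

/-- The chain rule for the bits of a word, conditionally on `S`. -/
theorem map_prodMk_eq_mul_prod_condBit (s : σ) (u : Word n) :
    P.map (fun o => (S o, U o)) (s, u) =
      P.map S s *
        ∏ i, condBit P (fun o => U o i) (fun o => (S o, past (U o) i)) (s, past u i) (u i) := by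
  let c : ℕ → ℝ≥0∞ := fun i => if h : i < 2 ^ n then
    condBit P (fun o => U o ⟨i, h⟩) (fun o => (S o, past (U o) ⟨i, h⟩)) (s, past u ⟨i, h⟩)
      (u ⟨i, h⟩) else 1
  have key : ∀ m, m ≤ 2 ^ n →
      expect P (fun o => ind (S o = s ∧ ∀ j : Fin (2 ^ n), j.val < m → U o j = u j)) =
        P.map S s * ∏ i ∈ Finset.range m, c i := by
    intro m
    induction m with
    | zero => intro _; simp [map_eq_expect P S]
    | succ m ih =>
      intro hm
      have h := expect_agree_succ P S U s u ⟨m, hm⟩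
      rw [Finset.prod_range_succ, ← mul_assoc, ← ih (by omega), h]
      have hc : c m = _ := dif_pos (show m < 2 ^ n from hm)
      rw [hc]
  have h := key (2 ^ n) le_rfl
  rw [Finset.prod_range] at h
  simp only [c, Fin.is_lt, dite_true, Fin.eta] at h
  rw [← h, map_eq_expect]
  simp_rw [Prod.mk.injEq, funext_iff]
  congr 1
  funext o
  simp

end ChainRule

section Source

variable {Y : Rcv → Type*} (M : Model Y)

/-- The law of the letters `(W, V, X)`. -/
noncomputable def Model.wordLetterLaw : PMF (Layer → Bit) :=
  M.pWV.bind fun wv => (M.pXV wv.2).map fun x => letters wv.1 wv.2 x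

theorem Model.letterLaw_eq :
    M.letterLaw = M.wordLetterLaw.bind fun a => (M.chan (a .x)).map fun y => (a, y) := by
  unfold Model.letterLaw Model.wordLetterLaw
  rw [PMF.bind_bind]
  congr 1
  funext wv
  rw [PMF.bind_map]
  congr 1

/-- The law of the outputs of `N` uses of the channel. -/
noncomputable def Model.chanN {n : ℕ} (x : Word n) : PMF (Fin (2 ^ n) → ∀ j, Y j) :=
  pmfPi fun i => M.chan (x i)

theorem Model.iidLaw_eq (n : ℕ) :
    M.iidLaw n = (pmfPi fun _ => M.wordLetterLaw).bind fun a =>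
      (M.chanN fun i => a i .x).map fun y i => (a i, y i) := by
  unfold Model.iidLaw Model.chanN
  simp_rw [Model.letterLaw_eq, pmfPi_bind, pmfPi_map]

/-- The outputs are those of the channel with input `X = U_x G_N`. -/
theorem Model.expect_iidLaw_uOf (n : ℕ)
    (f : (Layer → Word n) → (Fin (2 ^ n) → ∀ j, Y j) → ℝ≥0∞) :
    expect (M.iidLaw n) (fun o => f (uOf o) fun i => (o i).2) =
      expect ((M.iidLaw n).map uOf) fun u => expect (M.chanN (polar (u .x))) (f u) := by
  have h : ∀ g : Outcome Y n → ℝ≥0∞, expect (M.iidLaw n) g =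
      expect (pmfPi fun _ : Fin (2 ^ n) => M.wordLetterLaw) fun a =>
        expect (M.chanN fun i => a i .x) fun y => g fun i => (a i, y i) := by
    intro g
    rw [Model.iidLaw_eq, expect_bind]
    simp_rw [expect_map]
  rw [expect_map, h, h]
  congr 1
  funext a
  have e : ∀ y : Fin (2 ^ n) → ∀ j, Y j,
      (uOf (fun i => (a i, y i)) : Layer → Word n) = fun l => polar fun i => a i l := fun y => rfl
  simp_rw [e, polar_polar, expect_const]

theorem expect_iidLaw_forall {γ : Type*} (n : ℕ) (g : (Layer → Bit) → γ) (c : Fin (2 ^ n) → γ) :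
    expect (M.iidLaw n) (fun o => ind (∀ i, g (o i).1 = c i)) =
      ∏ i, M.wordLetterLaw.map g (c i) := by
  simp_rw [ind_forall]
  unfold Model.iidLaw
  rw [expect_pmfPi_prod (fun _ : Fin (2 ^ n) => M.letterLaw) fun i q => ind (g q.1 = c i)]
  refine Finset.prod_congr rfl fun i _ => ?_
  rw [Model.letterLaw_eq, expect_bind, map_eq_expect]
  simp_rw [expect_map, expect_const]

theorem expect_wordLetterLaw (f : (Layer → Bit) → ℝ≥0∞) :
    expect M.wordLetterLaw f =
      expect M.pWV fun wv => expect (M.pXV wv.2) fun x => f (letters wv.1 wv.2 x) := by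
  unfold Model.wordLetterLaw
  rw [expect_bind]
  simp_rw [expect_map]

/-- `W → V → X` is a Markov chain. -/
theorem wordLetterLaw_markov (w v x : Bit) :
    M.wordLetterLaw.map (fun a => (a .w, a .v, a .x)) (w, v, x) *
        M.wordLetterLaw.map (fun a => a .v) v =
      M.wordLetterLaw.map (fun a => (a .w, a .v)) (w, v) *
        M.wordLetterLaw.map (fun a => (a .v, a .x)) (v, x) := by
  have e : ∀ wv : Bit × Bit, ind (wv.2 = v) * M.pXV wv.2 x = ind (wv.2 = v) * M.pXV v x := by
    intro wv
    by_cases h : wv.2 = v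
    · rw [h]
    · rw [ind_neg h, zero_mul, zero_mul]
  simp_rw [map_eq_expect, expect_wordLetterLaw, letters, Prod.mk.injEq, ind_and, expect_mul_left,
    ← apply_eq_expect, expect_const, e, ← mul_assoc, expect_mul_right]
  ring

/-- The words `W, V, X` of length `N` inherit the Markov property of the letters. -/
theorem iidLaw_markov {n : ℕ} (a : Layer → Word n) :
    expect (M.iidLaw n) (fun o => ind (wordOf o = a)) *
        expect (M.iidLaw n) (fun o => ind (wordOf o .v = a .v)) =
      expect (M.iidLaw n) (fun o => ind (wordOf o .w = a .w ∧ wordOf o .v = a .v)) *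
        expect (M.iidLaw n) (fun o => ind (wordOf o .v = a .v ∧ wordOf o .x = a .x)) := by
  have h3 := expect_iidLaw_forall M n (fun b => (b .w, b .v, b .x))
    fun i => (a .w i, a .v i, a .x i)
  have h1 := expect_iidLaw_forall M n (fun b => b .v) fun i => a .v i
  have hwv := expect_iidLaw_forall M n (fun b => (b .w, b .v)) fun i => (a .w i, a .v i)
  have hvx := expect_iidLaw_forall M n (fun b => (b .v, b .x)) fun i => (a .v i, a .x i)
  have e3 : ∀ o : Outcome Y n, wordOf o = a ↔
      ∀ i, (o i).1 .w = a .w i ∧ (o i).1 .v = a .v i ∧ (o i).1 .x = a .x i := by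
    refine fun o => ⟨fun h i => by rw [← h]; exact ⟨rfl, rfl, rfl⟩, fun h => ?_⟩
    funext l i
    cases l
    exacts [(h i).1, (h i).2.1, (h i).2.2]
  simp_rw [Prod.mk.injEq] at h3 hwv hvx
  simp_rw [e3, funext_iff, ← forall_and]
  refine (congrArg₂ (· * ·) h3 h1).trans (Eq.trans ?_ (congrArg₂ (· * ·) hwv hvx).symm)
  simp_rw [← Finset.prod_mul_distrib, wordLetterLaw_markov]

theorem polar_eq_iff {n : ℕ} (a u : Word n) : polar a = u ↔ a = polar u :=
  ⟨fun h => by rw [← h, polar_polar], fun h => by rw [h, polar_polar]⟩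

/-- The chain rule within layer `l`. -/
theorem expect_parent_uOf {n : ℕ} (l : Layer) (u : Layer → Word n) :
    expect (M.iidLaw n) (fun o => ind (parent (wordOf o) l = parent (fun l' => polar (u l')) l ∧
        wordOf o l = polar (u l))) =
      expect (M.iidLaw n) (fun o => ind (parent (wordOf o) l = parent (fun l' => polar (u l')) l)) *
        ∏ i, M.encProb n l i (ctxAt u l i) (u l i) := by
  have h := map_prodMk_eq_mul_prod_condBit (M.iidLaw n) (fun o => parent (wordOf o) l)
    (fun o => uOf o l) (parent (fun l' => polar (u l')) l) (u l)
  rw [map_eq_expect, map_eq_expect] at h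
  simp_rw [Prod.mk.injEq, uOf, polar_eq_iff] at h
  exact h

/-- Under the i.i.d. law the vectors `U_w, U_v, U_x` are produced bit by bit, each with its
conditional law given its context. For layer `x` this uses that `X` depends on `W` only
through `V`. -/
theorem map_uOf_eq_kernelProd {n : ℕ} (u : Layer → Word n) :
    (M.iidLaw n).map uOf u = kernelProd (M.encProb n) u := by
  have hw := expect_parent_uOf M .w u
  have hv := expect_parent_uOf M .v u
  have hx := expect_parent_uOf M .x u
  have hm := iidLaw_markov M fun l => polar (u l)
  simp only [parent, true_and] at hw hv hx
  rw [ind_pos trivial, expect_const, one_mul] at hw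
  have hu : ∀ o : Outcome Y n, uOf o = u ↔ wordOf o = fun l => polar (u l) := fun o => by
    simp_rw [funext_iff (f := uOf o), funext_iff (f := wordOf o), uOf, polar_eq_iff]
  rw [map_eq_expect, kernelProd, prod_layer]
  simp_rw [hu]
  rw [hx, hv, hw] at hm
  -- The Markov identity determines the law only after division by `P(V = v)`.
  by_cases h0 : expect (M.iidLaw n) (fun o => ind (wordOf o .v = polar (u .v))) = 0
  · have hvz : expect (M.iidLaw n)
        (fun o => ind (wordOf o .w = polar (u .w) ∧ wordOf o .v = polar (u .v))) = 0 :=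
      le_antisymm (h0 ▸ expect_mono _ fun o => ind_mono fun h => h.2) zero_le
    rw [← mul_assoc, ← hw, ← hv, hvz, zero_mul]
    exact le_antisymm (h0 ▸ expect_mono _ fun o => ind_mono fun h => congrFun h .v) zero_le
  · refine (ENNReal.mul_left_inj h0 (ne_top_of_le_ne_top ENNReal.one_ne_top
      (expect_le_one _ fun o => ind_le_one _))).1 (hm.trans ?_)
    ring

end Source

/-! ### Degradedness and the index sets -/

section Degraded

variable {Y : Rcv → Type*} (M : Model Y)

theorem ctxOf_eq_ctxAt {n : ℕ} (l : Layer) (i : Fin (2 ^ n)) (o : Outcome Y n) :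
    ctxOf l i o = ctxAt (uOf o) l i := by
  simp only [ctxOf, ctxAt, uOf, polar_polar]

theorem Model.chan_map_r2 (x : Bit) :
    (M.chan x).map (fun y => y .r2) = ((M.chan x).map fun y => y .r1).bind M.pY2 := by
  unfold Model.chan
  simp only [PMF.map_bind, PMF.map_comp, Function.comp_def, PMF.bind_bind]
  congr 1
  funext a
  rw [show (M.pY2 a.1).map (fun y => y) = M.pY2 a.1 from PMF.map_id _,
    show (M.pY2 a.1).map (fun _ => a.1) = PMF.pure a.1 from PMF.map_const _ _, PMF.pure_bind]

/-- The output of receiver 2 is obtained from that of receiver 1 through the channel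
`p(y₂|y₁)`. -/
theorem Model.expect_iidLaw_r2 (n : ℕ) (f : (Layer → Word n) → (Fin (2 ^ n) → Y .r2) → ℝ≥0∞) :
    expect (M.iidLaw n) (fun o => f (uOf o) (outOf .r2 o)) =
      expect (M.iidLaw n) fun o => expect (pmfPi fun i => M.pY2 (outOf .r1 o i)) (f (uOf o)) := by
  refine (M.expect_iidLaw_uOf n fun u y => f u fun i => y i .r2).trans
    (Eq.trans ?_ (M.expect_iidLaw_uOf n fun u y =>
      expect (pmfPi fun i => M.pY2 (y i .r1)) (f u)).symm)
  congr 1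
  funext u
  unfold Model.chanN
  rw [← expect_map _ (fun (y : Fin (2 ^ n) → ∀ j, Y j) i => y i .r2),
    ← expect_map _ (fun (y : Fin (2 ^ n) → ∀ j, Y j) i => y i .r1)
      (fun y1 => expect (pmfPi fun i => M.pY2 (y1 i)) (f u)),
    ← pmfPi_map _ (fun _ (y : ∀ j, Y j) => y .r2), ← pmfPi_map _ (fun _ (y : ∀ j, Y j) => y .r1)]
  simp_rw [Model.chan_map_r2]
  rw [pmfPi_bind _ fun _ => M.pY2, expect_bind]

theorem Model.bhatt_r1_le_r2 (n : ℕ) (l : Layer) (i : Fin (2 ^ n)) :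
    bhatt (M.iidLaw n) (fun o => uOf o l i) (ctxOutOf .r1 l i) ≤
      bhatt (M.iidLaw n) (fun o => uOf o l i) (ctxOutOf .r2 l i) := by
  refine bhatt_le_of_degraded _ _ _ _
    (fun s t => ind (s.1 = t.1) * (pmfPi fun i => M.pY2 (s.2 i)) t.2) (fun s => ?_) fun t b => ?_
  · rw [ENNReal.tsum_prod']
    simp_rw [ENNReal.tsum_mul_left, PMF.tsum_coe]
    exact tsum_ind_mul s.1 fun _ => 1
  · have h := M.expect_iidLaw_r2 n fun u y2 =>
      ind (ctxAt u l i = t.1) * ind (u l i = b) * ind (y2 = t.2)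
    simp_rw [expect_mul_left, ← apply_eq_expect] at h
    rw [map_eq_expect, tsum_joint_mul]
    obtain ⟨c, y2⟩ := t
    simp_rw [ctxOutOf, ctxOf_eq_ctxAt, Prod.mk.injEq, ind_and]
    simp_rw [mul_right_comm _ _ (ind (uOf _ l i = b))]
    exact h

theorem Model.setL_subset_setLY (n : ℕ) (β : ℝ) (j : Rcv) (l : Layer) :
    M.setL n β l ⊆ M.setLY n β j l := by
  intro i hi
  simp only [Model.setL, Model.setLY, Finset.mem_filter, Finset.mem_univ, true_and] at hi ⊢
  exact (bhatt_prodMk_le (M.iidLaw n) _ (ctxOf l i) (outOf j)).trans hi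

theorem Model.setI_r2_subset_r1 (n : ℕ) (β : ℝ) (l : Layer) :
    M.setI n β .r2 l ⊆ M.setI n β .r1 l := by
  refine Finset.inter_subset_inter_right fun i hi => ?_
  simp only [Model.setLY, Finset.mem_filter, Finset.mem_univ, true_and] at hi ⊢
  exact (M.bhatt_r1_le_r2 n l i).trans hi

theorem Model.setI_subset_setH (n : ℕ) (β : ℝ) (j : Rcv) (l : Layer) :
    M.setI n β j l ⊆ M.setH n β l := Finset.inter_subset_right

theorem delta_pos (β : ℝ) (n : ℕ) : 0 < delta β n := Real.rpow_pos_of_pos two_pos _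

theorem delta_lt_half {β : ℝ} (hβ : 0 < β) {n : ℕ} (hn : 1 ≤ n) : delta β n < 1 / 2 := by
  have h1 : (1 : ℝ) < 2 ^ n := one_lt_pow₀ one_lt_two (by omega)
  have h2 : (1 : ℝ) < ((2 : ℝ) ^ n) ^ β := Real.one_lt_rpow h1 hβ
  calc delta β n < (2 : ℝ) ^ (-1 : ℝ) :=
        Real.rpow_lt_rpow_of_exponent_lt one_lt_two (neg_lt_neg h2)
    _ = 1 / 2 := by rw [Real.rpow_neg_one]; norm_num

theorem Model.disjoint_setH_setL {β : ℝ} (hβ : 0 < β) {n : ℕ} (hn : 1 ≤ n) (l : Layer) :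
    Disjoint (M.setH n β l) (M.setL n β l) := by
  rw [Finset.disjoint_left]
  intro i hH hL
  simp only [Model.setH, Model.setL, Finset.mem_filter, Finset.mem_univ, true_and] at hH hL
  have h := hH.trans hL
  rw [ENNReal.ofReal_le_ofReal_iff (delta_pos β n).le] at h
  linarith [delta_lt_half hβ hn]

end Degraded

/-! ### Replacing the conditional laws by those of the encoder -/

section Hybrid

theorem sum_snoc {m : ℕ} (f : (Fin (m + 1) → Bit) → ℝ≥0∞) :
    ∑ u, f u = ∑ u : Fin m → Bit, ∑ b, f (Fin.snoc u b) := by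
  rw [← (Fin.snocEquiv fun _ : Fin (m + 1) => Bit).sum_comp, Fintype.sum_prod_type,
    Finset.sum_comm]
  rfl

theorem past_snoc_castSucc {m : ℕ} (i : Fin m) (u : Fin m → Bit) (b : Bit) :
    (fun j : Fin i.val => (Fin.snoc u b : Fin (m + 1) → Bit)
      ⟨j.val, j.isLt.trans i.castSucc.isLt⟩) = fun j => u ⟨j.val, j.isLt.trans i.isLt⟩ :=
  funext fun j => Fin.snoc_castSucc (α := fun _ => Bit) b u ⟨j.val, j.isLt.trans i.isLt⟩

theorem past_snoc_last {m : ℕ} (u : Fin m → Bit) (b : Bit) :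
    (fun j : Fin m => (Fin.snoc u b : Fin (m + 1) → Bit)
      ⟨j.val, j.isLt.trans (Fin.last m).isLt⟩) = u :=
  funext fun j => Fin.snoc_castSucc (α := fun _ => Bit) b u j

theorem prod_kernel_snoc {m : ℕ} (r : ∀ i : Fin (m + 1), (Fin i.val → Bit) → Bit → ℝ≥0∞)
    (u : Fin m → Bit) (b : Bit) :
    ∏ i, r i (fun j => (Fin.snoc u b : Fin (m + 1) → Bit) ⟨j.val, j.isLt.trans i.isLt⟩)
        ((Fin.snoc u b : Fin (m + 1) → Bit) i) =
      (∏ i : Fin m, r i.castSucc (fun j => u ⟨j.val, j.isLt.trans i.isLt⟩) (u i)) *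
        r (Fin.last m) u b := by
  rw [Fin.prod_univ_castSucc]
  congr 1
  · refine Finset.prod_congr rfl fun i _ => ?_
    rw [Fin.snoc_castSucc]
    exact congrFun (congrArg (r i.castSucc) (past_snoc_castSucc i u b)) _
  · rw [Fin.snoc_last]
    exact congrFun (congrArg (r (Fin.last m)) (past_snoc_last u b)) _

/-- Sequential sampling with the kernels `q` instead of `p` changes the mean of a function bounded
by one at most by the sum of the mean distances of the kernels, the means being taken under
sampling with `p`. -/
theorem sum_prod_kernel_le : ∀ {m : ℕ} (p q : ∀ i : Fin m, (Fin i.val → Bit) → Bit → ℝ≥0∞)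
    (_ : ∀ i s, ∑ b, p i s b = 1) (_ : ∀ i s, ∑ b, q i s b = 1)
    (f : (Fin m → Bit) → ℝ≥0∞) (_ : ∀ u, f u ≤ 1),
    ∑ u : Fin m → Bit,
        (∏ i, q i (fun j => u ⟨j.val, j.isLt.trans i.isLt⟩) (u i)) * f u ≤
      ∑ u : Fin m → Bit,
        (∏ i, p i (fun j => u ⟨j.val, j.isLt.trans i.isLt⟩) (u i)) * f u +
      ∑ i, ∑ u : Fin m → Bit, (∏ i, p i (fun j => u ⟨j.val, j.isLt.trans i.isLt⟩) (u i)) *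
        ∑ b, (q i (fun j => u ⟨j.val, j.isLt.trans i.isLt⟩) b -
          p i (fun j => u ⟨j.val, j.isLt.trans i.isLt⟩) b)
  | 0, p, q, _, _, f, _ => by simp
  | m + 1, p, q, hp, hq, f, hf => by
    have hpast := past_snoc_castSucc (m := m)
    have hlast := past_snoc_last (m := m)
    have hprod := prod_kernel_snoc (m := m)
    set δ : ∀ i : Fin (m + 1), (Fin i.val → Bit) → ℝ≥0∞ := fun i s => ∑ b, (q i s b - p i s b)
      with hδ
    let g : (Fin m → Bit) → ℝ≥0∞ := fun u => ∑ b, q (Fin.last m) u b * f (Fin.snoc u b)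
    have hg : ∀ u, g u ≤ 1 := fun u => by
      refine le_trans (Finset.sum_le_sum fun b _ => mul_le_of_le_one_right zero_le (hf _)) ?_
      exact (hq (Fin.last m) u).le
    have hstep : ∀ u, g u ≤ ∑ b, p (Fin.last m) u b * f (Fin.snoc u b) + δ (Fin.last m) u := by
      intro u
      rw [hδ, ← Finset.sum_add_distrib]
      refine Finset.sum_le_sum fun b _ => ?_
      calc q (Fin.last m) u b * f (Fin.snoc u b)
          ≤ (p (Fin.last m) u b + (q (Fin.last m) u b - p (Fin.last m) u b)) *
            f (Fin.snoc u b) := mul_le_mul_left le_add_tsub _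
        _ ≤ _ := by
          rw [add_mul]
          exact add_le_add_right (mul_le_of_le_one_right zero_le (hf _)) _
    -- The last kernel is replaced inside the mean `g` over the last bit; the induction hypothesis
    -- for `g` replaces the others.
    have ih := sum_prod_kernel_le (fun i : Fin m => p i.castSucc) (fun i : Fin m => q i.castSucc)
      (fun i s => hp i.castSucc s) (fun i s => hq i.castSucc s) g hg
    have hfac : ∀ (A c : ℝ≥0∞) (u : Fin m → Bit),
        ∑ b, A * p (Fin.last m) u b * c = A * c := fun A c u => by
      have := hp (Fin.last m) u
      rw [← Finset.sum_mul, ← Finset.mul_sum]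
      exact congrArg (fun z => A * z * c) this |>.trans (by rw [mul_one])
    rw [sum_snoc, sum_snoc, Fin.sum_univ_castSucc]
    simp_rw [sum_snoc, hprod]
    have hD : ∀ i : Fin m, (∑ u : Fin m → Bit, ∑ b,
          (∏ i : Fin m, p i.castSucc (fun j => u ⟨j.val, j.isLt.trans i.isLt⟩) (u i)) *
            p (Fin.last m) u b * δ i.castSucc (fun j => (Fin.snoc u b : Fin (m + 1) → Bit)
              ⟨j.val, j.isLt.trans i.castSucc.isLt⟩)) =
        ∑ u : Fin m → Bit,
          (∏ i : Fin m, p i.castSucc (fun j => u ⟨j.val, j.isLt.trans i.isLt⟩) (u i)) *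
            δ i.castSucc fun j => u ⟨j.val, j.isLt.trans i.isLt⟩ := by
      intro i
      refine Finset.sum_congr rfl fun u _ => ?_
      rw [← hfac _ _ u]
      exact Finset.sum_congr rfl fun b _ => congrArg _ (congrArg (δ i.castSucc) (hpast i u b))
    have hL : (∑ u : Fin m → Bit, ∑ b,
          (∏ i : Fin m, p i.castSucc (fun j => u ⟨j.val, j.isLt.trans i.isLt⟩) (u i)) *
            p (Fin.last m) u b * δ (Fin.last m) (fun j => (Fin.snoc u b : Fin (m + 1) → Bit)
              ⟨j.val, j.isLt.trans (Fin.last m).isLt⟩)) =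
        ∑ u : Fin m → Bit,
          (∏ i : Fin m, p i.castSucc (fun j => u ⟨j.val, j.isLt.trans i.isLt⟩) (u i)) *
            δ (Fin.last m) u := by
      refine Finset.sum_congr rfl fun u _ => ?_
      rw [← hfac _ _ u]
      exact Finset.sum_congr rfl fun b _ => congrArg _ (congrArg (δ (Fin.last m)) (hlast u b))
    refine le_trans (le_of_eq ?_) (ih.trans ?_)
    · simp_rw [g, Finset.mul_sum, mul_assoc]
      rfl
    · refine (add_le_add_left (Finset.sum_le_sum fun u _ => mul_le_mul_right (hstep u) _) _).trans
        (le_of_eq ?_)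
      refine Eq.trans ?_ (congrArg₂ (· + ·) rfl
        (congrArg₂ (· + ·) (Finset.sum_congr rfl fun i _ => hD i) hL).symm)
      simp_rw [mul_add, Finset.sum_add_distrib]
      refine (add_assoc _ _ _).trans (congrArg₂ (· + ·) ?_ (add_comm _ _))
      simp_rw [Finset.mul_sum, mul_assoc]
      rfl

end Hybrid

section LayeredHybrid

theorem sum_layers {α : Type*} [Fintype α] {R : Type*} [AddCommMonoid R] (f : (Layer → α) → R) :
    ∑ u, f u = ∑ w, ∑ v, ∑ x, f (letters w v x) := by
  let e : α × α × α ≃ (Layer → α) :=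
    { toFun := fun t => letters t.1 t.2.1 t.2.2
      invFun := fun u => (u .w, u .v, u .x)
      left_inv := fun _ => rfl
      right_inv := fun u => by funext l; cases l <;> rfl }
  rw [← e.sum_comp, Fintype.sum_prod_type]
  simp_rw [Fintype.sum_prod_type]
  rfl

/-- The total weight of sequential sampling. -/
theorem sum_prod_kernel_eq_one : ∀ {m : ℕ} (p : ∀ i : Fin m, (Fin i.val → Bit) → Bit → ℝ≥0∞)
    (_ : ∀ i s, ∑ b, p i s b = 1),
    ∑ u : Fin m → Bit, ∏ i, p i (fun j => u ⟨j.val, j.isLt.trans i.isLt⟩) (u i) = 1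
  | 0, p, _ => by simp
  | m + 1, p, hp => by
    rw [sum_snoc, ← sum_prod_kernel_eq_one (fun i : Fin m => p i.castSucc) fun i => hp i.castSucc]
    refine Finset.sum_congr rfl fun u _ => ?_
    have h : ∀ b, ∏ i, p i (fun j => (Fin.snoc u b : Fin (m + 1) → Bit)
        ⟨j.val, j.isLt.trans i.isLt⟩) ((Fin.snoc u b : Fin (m + 1) → Bit) i) =
          (∏ i : Fin m, p i.castSucc (fun j => u ⟨j.val, j.isLt.trans i.isLt⟩) (u i)) *
            p (Fin.last m) u b := prod_kernel_snoc p u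
    simp_rw [h]
    have := hp (Fin.last m) u
    rw [← Finset.mul_sum]
    exact congrArg _ this |>.trans (mul_one _)

variable {n : ℕ}

/-- The weight of the word of layer `l` given its conditioning word `s`. -/
noncomputable def layerProd (κ : ∀ (_ : Layer) (i : Fin (2 ^ n)), Ctx n i → Bit → ℝ≥0∞) (l : Layer)
    (s u : Word n) : ℝ≥0∞ :=
  ∏ i, κ l i (s, past u i) (u i)

theorem kernelProd_letters (κ : ∀ (_ : Layer) (i : Fin (2 ^ n)), Ctx n i → Bit → ℝ≥0∞)
    (w v x : Word n) :
    kernelProd κ (letters w v x) =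
      layerProd κ .w 0 w * (layerProd κ .v (polar w) v * layerProd κ .x (polar v) x) := by
  rw [kernelProd, prod_layer]
  rfl

variable (p q : ∀ (_ : Layer) (i : Fin (2 ^ n)), Ctx n i → Bit → ℝ≥0∞)

theorem sum_layerProd (hp : ∀ l i s, ∑ b, p l i s b = 1) (l : Layer) (s : Word n) :
    ∑ u, layerProd p l s u = 1 :=
  sum_prod_kernel_eq_one (fun i t => p l i (s, t)) fun i t => hp l i (s, t)

theorem sum_layerProd_le (hp : ∀ l i s, ∑ b, p l i s b = 1) (hq : ∀ l i s, ∑ b, q l i s b = 1)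
    (l : Layer) (s : Word n) (f : Word n → ℝ≥0∞) (hf : ∀ u, f u ≤ 1) :
    ∑ u, layerProd q l s u * f u ≤
      ∑ u, layerProd p l s u * f u +
        ∑ u, layerProd p l s u * ∑ i, ∑ b, (q l i (s, past u i) b - p l i (s, past u i) b) := by
  refine (sum_prod_kernel_le (fun i t => p l i (s, t)) (fun i t => q l i (s, t))
    (fun i t => hp l i (s, t)) (fun i t => hq l i (s, t)) f hf).trans (le_of_eq ?_)
  congr 1
  simp_rw [Finset.mul_sum (s := (Finset.univ : Finset (Fin (2 ^ n))))]
  exact Finset.sum_comm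

theorem sum_layerProd_mul_le_one (hq : ∀ l i s, ∑ b, q l i s b = 1)
    (l : Layer) (s : Word n) (f : Word n → ℝ≥0∞) (hf : ∀ u, f u ≤ 1) :
    ∑ u, layerProd q l s u * f u ≤ 1 :=
  (Finset.sum_le_sum fun u _ => mul_le_of_le_one_right zero_le (hf u)).trans_eq
    (sum_layerProd q hq l s)

/-- The three layers together: sampling with the kernels `q` instead of `p` changes the mean of a
function bounded by one at most by the sum over all positions of the mean distances of the
kernels. -/
theorem sum_kernelProd_le (hp : ∀ l i s, ∑ b, p l i s b = 1)
    (hq : ∀ l i s, ∑ b, q l i s b = 1) (h : (Layer → Word n) → ℝ≥0∞) (hh : ∀ u, h u ≤ 1) :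
    ∑ u, kernelProd q u * h u ≤
      ∑ u, kernelProd p u * h u +
        ∑ l, ∑ i, ∑ u, kernelProd p u * ∑ b, (q l i (ctxAt u l i) b - p l i (ctxAt u l i) b) := by
  let d : Layer → Word n → Word n → ℝ≥0∞ := fun l s u =>
    ∑ i, ∑ b, (q l i (s, past u i) b - p l i (s, past u i) b)
  let h2 : Word n → Word n → ℝ≥0∞ := fun w v =>
    ∑ x, layerProd q .x (polar v) x * h (letters w v x)
  let h1 : Word n → ℝ≥0∞ := fun w => ∑ v, layerProd q .v (polar w) v * h2 w v
  have hh2 : ∀ w v, h2 w v ≤ 1 := fun w v => sum_layerProd_mul_le_one q hq _ _ _ fun _ => hh _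
  have hh1 : ∀ w, h1 w ≤ 1 := fun w => sum_layerProd_mul_le_one q hq _ _ _ fun _ => hh2 _ _
  have e1 := sum_layerProd_le p q hp hq .w 0 h1 hh1
  have e2 := fun w => sum_layerProd_le p q hp hq .v (polar w) (h2 w) (hh2 w)
  have e3 := fun w v => sum_layerProd_le p q hp hq .x (polar v) (fun x => h (letters w v x))
    fun _ => hh _
  have hL : ∑ u, kernelProd q u * h u = ∑ w, layerProd q .w 0 w * h1 w := by
    simp_rw [sum_layers, kernelProd_letters, h1, h2, Finset.mul_sum, mul_assoc]
  have hE : ∑ l, ∑ i, ∑ u, kernelProd p u *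
        ∑ b, (q l i (ctxAt u l i) b - p l i (ctxAt u l i) b) =
      ∑ u, kernelProd p u * (d .w 0 (u .w) + d .v (polar (u .w)) (u .v) +
        d .x (polar (u .v)) (u .x)) := by
    simp_rw [Finset.sum_comm (s := (Finset.univ : Finset (Fin (2 ^ n)))), ← Finset.mul_sum,
      sum_layer, ← Finset.sum_add_distrib, ← mul_add, add_assoc]
    rfl
  have hone := sum_layerProd p hp
  rw [hL, hE]
  refine e1.trans ?_
  simp_rw [sum_layers, kernelProd_letters, mul_add, Finset.sum_add_distrib]
  refine (add_le_add_left (Finset.sum_le_sum fun w _ => mul_le_mul_right ((e2 w).trans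
    (add_le_add_left (Finset.sum_le_sum fun v _ => mul_le_mul_right (e3 w v) _) _)) _) _).trans
    (le_of_eq ?_)
  have hw : ∑ w, ∑ v, ∑ x, layerProd p .w 0 w *
      (layerProd p .v (polar w) v * layerProd p .x (polar v) x) * d .w 0 w =
      ∑ w, layerProd p .w 0 w * d .w 0 w := by
    refine Finset.sum_congr rfl fun w _ => ?_
    simp_rw [← Finset.sum_mul, ← Finset.mul_sum, hone, mul_one, hone, mul_one]
  have hv : ∑ w, ∑ v, ∑ x, layerProd p .w 0 w *
      (layerProd p .v (polar w) v * layerProd p .x (polar v) x) * d .v (polar w) v =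
      ∑ w, layerProd p .w 0 w * ∑ v, layerProd p .v (polar w) v * d .v (polar w) v := by
    refine Finset.sum_congr rfl fun w _ => ?_
    simp_rw [← Finset.sum_mul, ← Finset.mul_sum, hone, mul_one, mul_assoc, ← Finset.mul_sum]
  refine Eq.trans ?_ (congrArg₂ (· + ·) rfl
    (congrArg₂ (· + ·) (congrArg₂ (· + ·) hw hv) rfl).symm)
  simp_rw [mul_add, Finset.sum_add_distrib, mul_add, Finset.sum_add_distrib, Finset.mul_sum,
    mul_assoc]
  simp only [letters, d, Finset.mul_sum]
  ring

end LayeredHybrid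

/-! ### The law `Q` compared with the i.i.d. law -/

section QLaw

variable {Y : Rcv → Type*} (M : Model Y) {n : ℕ} {β : ℝ}

/-- The conditional law of a bit at the encoder, averaged over the random code: uniform on the
high-entropy positions, the mode on the low-entropy ones, the true conditional law elsewhere. -/
noncomputable def Model.encKernel (n : ℕ) (β : ℝ) (l : Layer) (i : Fin (2 ^ n)) (s : Ctx n i)
    (b : Bit) : ℝ≥0∞ :=
  if i ∈ M.setH n β l then 2⁻¹
  else if i ∈ M.setL n β l then ind (b = argmaxBit (M.encProb n l i s))
  else M.encProb n l i s b

theorem sum_encProb (l : Layer) (i : Fin (2 ^ n)) (s : Ctx n i) :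
    ∑ b, M.encProb n l i s b = 1 := sum_condBit _ _ _ _

theorem sum_encKernel (l : Layer) (i : Fin (2 ^ n)) (s : Ctx n i) :
    ∑ b, M.encKernel n β l i s b = 1 := by
  unfold Model.encKernel
  split_ifs
  · rw [sum_bit, ENNReal.inv_two_add_inv_two]
  · rw [Finset.sum_eq_single _ (fun b _ hb => ind_neg hb) fun h => absurd (Finset.mem_univ _) h,
      ind_pos rfl]
  · exact sum_encProb M l i s

theorem prod_eq_mul_mul {N : Type*} [Fintype N] [DecidableEq N] {H L : Finset N}
    (hd : Disjoint H L) (f : N → ℝ≥0∞) :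
    ∏ i, f i = (∏ i ∈ H, f i) * (∏ i ∈ L, f i) * ∏ i ∈ (H ∪ L)ᶜ, f i := by
  rw [← Finset.prod_union hd, Finset.prod_mul_prod_compl]

theorem Model.Q_eq_kernelProd (hβ : 0 < β) (hn : 1 ≤ n) (u : Layer → Word n) :
    M.Q n β u = kernelProd (M.encKernel n β) u := by
  refine Finset.prod_congr rfl fun l _ => ?_
  rw [prod_eq_mul_mul (M.disjoint_setH_setL hβ hn l)]
  congr 1
  · congr 1
    · exact (Finset.prod_eq_pow_card fun i hi => if_pos hi).symm
    · refine Finset.prod_congr rfl fun i hi => ?_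
      have hH : i ∉ M.setH n β l := Finset.disjoint_right.1 (M.disjoint_setH_setL hβ hn l) hi
      rw [Model.encKernel, if_neg hH, if_pos hi, ind_eq_ite]
      rfl
  · refine Finset.prod_congr rfl fun i hi => ?_
    have hi' : i ∈ (M.setH n β l ∪ M.setL n β l)ᶜ := hi
    rw [Finset.mem_compl, Finset.mem_union, not_or] at hi'
    rw [Model.encKernel, if_neg hi'.1, if_neg hi'.2]
    rfl

theorem delta_lt_one (hβ : 0 < β) (hn : 1 ≤ n) : delta β n < 1 :=
  (delta_lt_half hβ hn).trans (by norm_num)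

theorem delta_le_sqrt (hβ : 0 < β) (hn : 1 ≤ n) : delta β n ≤ √(delta β n) :=
  Real.le_sqrt_of_sq_le (by nlinarith [delta_pos β n, delta_lt_one hβ hn])

theorem expect_encKernel_tsub_le (hβ : 0 < β) (hn : 1 ≤ n) (l : Layer) (i : Fin (2 ^ n)) :
    expect (M.iidLaw n) (fun o => ∑ b, (M.encKernel n β l i (ctxOf l i o) b -
      M.encProb n l i (ctxOf l i o) b)) ≤ ENNReal.ofReal √(delta β n) := by
  unfold Model.encKernel
  split_ifs with hH hL
  · refine expect_half_tsub_condBit_le _ _ _ (Real.sqrt_pos.2 (delta_pos β n))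
      (Real.sqrt_le_one.2 (delta_lt_one hβ hn).le) ?_
    rw [Real.sq_sqrt (delta_pos β n).le]
    exact (Finset.mem_filter.1 hH).2
  · exact (expect_mode_tsub_condBit_le _ _ _).trans ((Finset.mem_filter.1 hL).2.trans
      (ENNReal.ofReal_le_ofReal (delta_le_sqrt hβ hn)))
  · simp_rw [tsub_self, Finset.sum_const_zero, expect_const]
    exact zero_le

theorem sum_encProb_kernelProd_mul (h : (Layer → Word n) → ℝ≥0∞) :
    ∑ u, kernelProd (M.encProb n) u * h u = expect (M.iidLaw n) fun o => h (uOf o) := by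
  simp_rw [← map_uOf_eq_kernelProd]
  rw [← expect_fintype, expect_map]

/-- The mean under `Q` is close to the mean under the i.i.d. law. -/
theorem sum_Q_mul_le (hβ : 0 < β) (hn : 1 ≤ n) (h : (Layer → Word n) → ℝ≥0∞)
    (hh : ∀ u, h u ≤ 1) :
    ∑ u, M.Q n β u * h u ≤ expect ((M.iidLaw n).map uOf) h +
      3 * (2 ^ n * ENNReal.ofReal √(delta β n)) := by
  simp_rw [M.Q_eq_kernelProd hβ hn]
  refine (sum_kernelProd_le (M.encProb n) (M.encKernel n β) (sum_encProb M) (sum_encKernel M) h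
    hh).trans ?_
  rw [sum_encProb_kernelProd_mul, expect_map]
  refine add_le_add_right ?_ _
  calc _ ≤ ∑ l : Layer, ∑ i : Fin (2 ^ n), ENNReal.ofReal √(delta β n) := by
        refine Finset.sum_le_sum fun l _ => Finset.sum_le_sum fun i _ => ?_
        rw [sum_encProb_kernelProd_mul M fun u => ∑ b, (M.encKernel n β l i (ctxAt u l i) b -
          M.encProb n l i (ctxAt u l i) b)]
        simp_rw [← ctxOf_eq_ctxAt]
        exact expect_encKernel_tsub_le M hβ hn l i
    _ = _ := by
        have h3 : Fintype.card Layer = 3 := rfl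
        simp [h3]

/-- All maximum a posteriori decisions of the three receivers about the bits of a block are right
when they are given the true context: those in `I_j` and those in the low-entropy set. -/
def Model.Decodable (M : Model Y) (β : ℝ) (u : Layer → Word n) (y : Fin (2 ^ n) → ∀ j, Y j) :
    Prop :=
  ∀ j l i, i ∈ M.setI n β j l ∪ M.setL n β l →
    argmaxBit (M.decProb n j l i (ctxAt u l i) fun m => y m j) = u l i

theorem ind_not_forall_rcv_le (p : Rcv → Prop) :
    ind (¬∀ j, p j) ≤ ind (¬p .r1) + ind (¬p .r2) + ind (¬p .r3) := by
  by_cases h1 : p .r1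
  · by_cases h2 : p .r2
    · refine le_trans (ind_mono fun h h3 => h fun j => ?_) le_add_self
      cases j <;> assumption
    · rw [ind_pos h2]
      exact (ind_le_one _).trans (le_add_self.trans le_self_add)
  · rw [ind_pos h1, add_assoc]
    exact (ind_le_one _).trans le_self_add

theorem expect_ind_decision_le (j : Rcv) (l : Layer) (i : Fin (2 ^ n)) :
    expect (M.iidLaw n) (fun o => ind (¬(i ∈ M.setI n β j l ∪ M.setL n β l →
      argmaxBit (M.decProb n j l i (ctxAt (uOf o) l i) (outOf j o)) = uOf o l i))) ≤
      ENNReal.ofReal (delta β n) := by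
  by_cases h : i ∈ M.setI n β j l ∪ M.setL n β l
  · have hLY : i ∈ M.setLY n β j l := by
      rcases Finset.mem_union.1 h with h | h
      · exact Finset.inter_subset_left h
      · exact M.setL_subset_setLY n β j l h
    refine le_trans ?_ (Finset.mem_filter.1 hLY).2
    refine le_trans (expect_mono _ fun o => ind_mono fun h' => ?_)
      (expect_argmaxBit_ne_le (M.iidLaw n) (fun o => uOf o l i) (ctxOutOf j l i))
    have h2 := (Classical.not_imp.1 h').2
    rwa [← ctxOf_eq_ctxAt] at h2
  · simp_rw [ind_neg (not_not.2 fun h' => absurd h' h), expect_const]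
    exact zero_le

theorem expect_not_decodable_le :
    expect (M.iidLaw n) (fun o => ind (¬M.Decodable β (uOf o) fun i => (o i).2)) ≤
      9 * (2 ^ n * ENNReal.ofReal (delta β n)) := by
  have hj : ∀ j, expect (M.iidLaw n) (fun o => ind (¬∀ l i, i ∈ M.setI n β j l ∪ M.setL n β l →
      argmaxBit (M.decProb n j l i (ctxAt (uOf o) l i) (outOf j o)) = uOf o l i)) ≤
      3 * (2 ^ n * ENNReal.ofReal (delta β n)) := by
    intro j
    calc _ ≤ expect (M.iidLaw n) (fun o => ∑ l, ∑ i, ind (¬(i ∈ M.setI n β j l ∪ M.setL n β l →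
          argmaxBit (M.decProb n j l i (ctxAt (uOf o) l i) (outOf j o)) = uOf o l i))) := by
          refine expect_mono _ fun o => ?_
          rw [not_forall]
          refine (ind_exists_le _).trans (Finset.sum_le_sum fun l _ => ?_)
          rw [not_forall]
          exact ind_exists_le _
      _ ≤ ∑ l : Layer, ∑ i : Fin (2 ^ n), ENNReal.ofReal (delta β n) := by
          simp_rw [expect_sum]
          exact Finset.sum_le_sum fun l _ => Finset.sum_le_sum fun i _ =>
            expect_ind_decision_le M j l i
      _ = _ := by
          have h3 : Fintype.card Layer = 3 := rfl
          simp [h3]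
  refine (expect_mono _ fun o => ind_not_forall_rcv_le _).trans ?_
  rw [expect_add, expect_add]
  refine (add_le_add (add_le_add (hj .r1) (hj .r2)) (hj .r3)).trans (le_of_eq ?_)
  ring

/-- The probability that a block drawn from `Q` and sent over the channel is not decodable. -/
theorem sum_Q_mul_not_decodable_le (hβ : 0 < β) (hn : 1 ≤ n) :
    ∑ u, M.Q n β u * expect (M.chanN (polar (u .x))) (fun y => ind (¬M.Decodable β u y)) ≤
      ENNReal.ofReal (12 * (2 ^ n * √(delta β n))) := by
  refine (sum_Q_mul_le M hβ hn _ fun u => expect_le_one _ fun y => ind_le_one _).trans ?_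
  rw [← M.expect_iidLaw_uOf n fun u y => ind (¬M.Decodable β u y)]
  have h2 : ENNReal.ofReal (12 * (2 ^ n * √(delta β n))) =
      12 * (2 ^ n * ENNReal.ofReal √(delta β n)) := by
    rw [ENNReal.ofReal_mul (by norm_num), ENNReal.ofReal_mul (by positivity),
      ENNReal.ofReal_pow (by norm_num)]
    norm_num
  rw [h2]
  refine (add_le_add_left ((expect_not_decodable_le M).trans (mul_le_mul_right (mul_le_mul_right
    (ENNReal.ofReal_le_ofReal (delta_le_sqrt hβ hn)) _) _)) _).trans (le_of_eq ?_)
  ring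

end QLaw

/-! ### Successive construction of the layers -/

section Layered

variable {n : ℕ}

theorem seqBuild_eq (rule : ∀ i : Fin (2 ^ n), (Fin i.val → Bit) → Bit) (i : Fin (2 ^ n)) :
    seqBuild rule i = rule i (past (seqBuild rule) i) := by
  rw [seqBuild]
  rfl

theorem seqBuild_eq_of {rule : ∀ i : Fin (2 ^ n), (Fin i.val → Bit) → Bit} {u : Word n}
    (h : ∀ i, u i = rule i (past u i)) : seqBuild rule = u := by
  have key : ∀ (m : ℕ) (i : Fin (2 ^ n)), i.val = m → seqBuild rule i = u i := by
    intro m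
    induction m using Nat.strong_induction_on with
    | _ m ih =>
      intro i hi
      rw [seqBuild_eq, h i]
      congr 1
      funext j
      exact ih j.val (hi ▸ j.isLt) _ rfl
  exact funext fun i => key _ i rfl

theorem layered_apply (rule : ∀ (_ : Layer) (i : Fin (2 ^ n)), Ctx n i → Bit) (l : Layer)
    (i : Fin (2 ^ n)) : layered rule l i = rule l i (ctxAt (layered rule) l i) := by
  cases l
  · exact seqBuild_eq _ i
  · exact seqBuild_eq _ i
  · exact seqBuild_eq _ i

/-- If the vectors `u` satisfy the successive rules in an initial segment of the layers, then the
construction yields `u` there. -/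
theorem layered_eq_of {rule : ∀ (_ : Layer) (i : Fin (2 ^ n)), Ctx n i → Bit}
    {u : Layer → Word n} {ok : Layer → Prop} (hv : ok .v → ok .w) (hx : ok .x → ok .v)
    (h : ∀ l, ok l → ∀ i, u l i = rule l i (ctxAt u l i)) :
    ∀ l, ok l → layered rule l = u l := by
  have h1 : ok .w → layered rule .w = u .w := fun hw => seqBuild_eq_of (h .w hw)
  have h2 : ok .v → layered rule .v = u .v := fun hv' => by
    refine seqBuild_eq_of (rule := fun i p => rule .v i (polar (layered rule .w), p)) fun i => ?_
    rw [h1 (hv hv')]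
    exact h .v hv' i
  have h3 : ok .x → layered rule .x = u .x := fun hx' => by
    refine seqBuild_eq_of (rule := fun i p => rule .x i (polar (layered rule .v), p)) fun i => ?_
    rw [h2 (hx hx')]
    exact h .x hx' i
  intro l
  cases l
  exacts [h1, h2, h3]

theorem layered_eq_iff (rule : ∀ (_ : Layer) (i : Fin (2 ^ n)), Ctx n i → Bit)
    (u : Layer → Word n) :
    layered rule = u ↔ ∀ l i, rule l i (ctxAt u l i) = u l i := by
  refine ⟨fun h l i => ?_, fun h => funext fun l => ?_⟩
  · rw [← h]; exact (layered_apply rule l i).symm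
  · exact layered_eq_of (ok := fun _ => True) id id (fun l _ i => (h l i).symm) l trivial

end Layered

/-! ### Allocations -/

section Allocations

variable {Y : Rcv → Type*} {n k : ℕ}

/-- What the four kinds of allocations have in common. The copy targets lie outside the information
sets of receiver 3, the message positions of layer `w` and all copy sources inside. Those message
positions and copy targets that are not copy sources are information positions of receiver 2 in
layer `w` and of receiver 1 in layers `v` and `x`. The private positions of layer `v` are
information positions of receiver 3 unless that receiver needs nothing from layer `v`. -/
structure Alloc.Sound (A : Alloc n) (M : Model Y) (β : ℝ) : Prop where
  pubW_r3 : A.pubW ⊆ M.setI n β .r3 .w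
  pubW_r2 : A.pubW ⊆ M.setI n β .r2 .w
  chainW_r3 : A.chainW ⊆ M.setI n β .r3 .w
  tgtW_r2 : A.tgtW ⊆ M.setI n β .r2 .w
  tgtW_r3 : Disjoint A.tgtW (M.setI n β .r3 .w)
  privV_r1 : A.privV ⊆ M.setI n β .r1 .v
  tgtV_r1 : A.tgtV ⊆ M.setI n β .r1 .v
  tgtV_r3 : Disjoint A.tgtV (M.setI n β .r3 .v)
  chainV_r3 : A.chainV ⊆ M.setI n β .r3 .v
  chainP_r3 : A.chainP ⊆ M.setI n β .r3 .v
  chainV_privV : Disjoint A.chainV A.privV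
  chainV_chainP : Disjoint A.chainV A.chainP
  privV_r3 : A.privV ⊆ M.setI n β .r3 .v ∨ (A.chainV = ∅ ∧ A.tgtV = ∅)
  privX_r1 : A.privX ⊆ M.setI n β .r1 .x

theorem disjoint_setF_setI (M : Model Y) (β : ℝ) (j : Rcv) (l : Layer) :
    Disjoint (M.setF n β j l) (M.setI n β j l) := Finset.sdiff_disjoint

theorem Alloc.Valid.sound {A : Alloc n} {M : Model Y} {β : ℝ} {m0 m11 m12 : ℕ}
    (h : A.Valid M β m0 m11 m12) : A.Sound M β := by
  have dF := fun j l => disjoint_setF_setI (n := n) M β j l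
  obtain ⟨h, hX, -⟩ := h
  rcases h with h | h | h | h
  · obtain ⟨h1, h2, h3, -, h5, -, h7, h8, -, h10⟩ := h
    rw [Finset.subset_inter_iff] at h3 h5 h10
    have h8' := h8.trans Finset.sdiff_subset
    rw [Finset.subset_inter_iff] at h8'
    exact
      { pubW_r3 := h1 ▸ Finset.inter_subset_left
        pubW_r2 := h1 ▸ Finset.inter_subset_right
        chainW_r3 := h2 ▸ Finset.inter_subset_left
        tgtW_r2 := h5.1
        tgtW_r3 := Finset.disjoint_of_subset_left h5.2 (dF _ _)
        privV_r1 := h7 ▸ Finset.inter_subset_left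
        tgtV_r1 := h10.1
        tgtV_r3 := Finset.disjoint_of_subset_left h10.2 (dF _ _)
        chainV_r3 := h3.1
        chainP_r3 := h8'.1
        chainV_privV := Finset.disjoint_of_subset_left h3.2
          (Finset.disjoint_of_subset_right (h7 ▸ Finset.inter_subset_left) (dF _ _))
        chainV_chainP := Finset.disjoint_of_subset_right h8 Finset.disjoint_sdiff
        privV_r3 := Or.inl (h7 ▸ Finset.inter_subset_right)
        privX_r1 := hX }
  · obtain ⟨h1, h2, h3, -, h5, h6, -, h8, h9⟩ := h
    rw [Finset.subset_inter_iff] at h5 h6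
    exact
      { pubW_r3 := h1 ▸ Finset.inter_subset_left
        pubW_r2 := h1 ▸ Finset.inter_subset_right
        chainW_r3 := h2 ▸ Finset.inter_subset_left
        tgtW_r2 := h5.1
        tgtW_r3 := Finset.disjoint_of_subset_left h5.2 (dF _ _)
        privV_r1 := h6.1
        tgtV_r1 := h9 ▸ Finset.empty_subset _
        tgtV_r3 := h9 ▸ Finset.disjoint_empty_left _
        chainV_r3 := h3.trans Finset.sdiff_subset
        chainP_r3 := h8 ▸ Finset.empty_subset _
        chainV_privV := Finset.disjoint_of_subset_left h3 Finset.sdiff_disjoint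
        chainV_chainP := h8 ▸ Finset.disjoint_empty_right _
        privV_r3 := Or.inl h6.2
        privX_r1 := hX }
  · obtain ⟨-, h1, h2, -, h4, h5, h6, -, h8, h9⟩ := h
    rw [Finset.subset_inter_iff] at h2 h5
    exact
      { pubW_r3 := h1 ▸ Finset.inter_subset_left
        pubW_r2 := h1 ▸ Finset.inter_subset_right
        chainW_r3 := h2.1
        tgtW_r2 := h5.1
        tgtW_r3 := Finset.disjoint_of_subset_left h5.2 (dF _ _)
        privV_r1 := h6
        tgtV_r1 := h9 ▸ Finset.empty_subset _
        tgtV_r3 := h9 ▸ Finset.disjoint_empty_left _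
        chainV_r3 := h4 ▸ Finset.empty_subset _
        chainP_r3 := h8 ▸ Finset.empty_subset _
        chainV_privV := h4 ▸ Finset.disjoint_empty_left _
        chainV_chainP := h8 ▸ Finset.disjoint_empty_right _
        privV_r3 := Or.inr ⟨h4, h9⟩
        privX_r1 := hX }
  · obtain ⟨h1, -, h2, h3, h4, h5, -, h7, h8⟩ := h
    rw [Finset.subset_inter_iff] at h1
    exact
      { pubW_r3 := h1.1
        pubW_r2 := h1.2
        chainW_r3 := h2 ▸ Finset.empty_subset _
        tgtW_r2 := h4 ▸ Finset.empty_subset _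
        tgtW_r3 := h4 ▸ Finset.disjoint_empty_left _
        privV_r1 := h5
        tgtV_r1 := h8 ▸ Finset.empty_subset _
        tgtV_r3 := h8 ▸ Finset.disjoint_empty_left _
        chainV_r3 := h3 ▸ Finset.empty_subset _
        chainP_r3 := h7 ▸ Finset.empty_subset _
        chainV_privV := h3 ▸ Finset.disjoint_empty_left _
        chainV_chainP := h7 ▸ Finset.disjoint_empty_right _
        privV_r3 := Or.inr ⟨h3, h8⟩
        privX_r1 := hX }

theorem Alloc.dst_eq_some {A : Alloc n} {l : Layer} {i : Fin (2 ^ n)} {p : Layer × Fin (2 ^ n)}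
    (h : A.dst l i = some p) : A.src p.1 p.2 = some (l, i) := by
  cases l
  · simp only [Alloc.dst] at h
    split_ifs at h with hi
    cases h
    simp [Alloc.src]
  · simp only [Alloc.dst] at h
    split_ifs at h with hi hi'
    · cases h
      simp [Alloc.src]
    · cases h
      simp [Alloc.src]
  · cases h

theorem Alloc.src_w_eq_some {A : Alloc n} {i : Fin (2 ^ n)} {p : Layer × Fin (2 ^ n)}
    (h : A.src .w i = some p) :
    i ∈ A.tgtW ∧ ((p.1 = .w ∧ p.2 ∈ A.chainW) ∨ (p.1 = .v ∧ p.2 ∈ A.chainV)) := by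
  simp only [Alloc.src] at h
  split_ifs at h with hi
  refine ⟨hi, ?_⟩
  rcases hq : A.pubLink.symm ⟨i, hi⟩ with a | a
  · rw [hq] at h; cases h; exact Or.inl ⟨rfl, a.2⟩
  · rw [hq] at h; cases h; exact Or.inr ⟨rfl, a.2⟩

theorem Alloc.src_v_eq_some {A : Alloc n} {i : Fin (2 ^ n)} {p : Layer × Fin (2 ^ n)}
    (h : A.src .v i = some p) : i ∈ A.tgtV ∧ p.1 = .v ∧ p.2 ∈ A.chainP := by
  simp only [Alloc.src] at h
  split_ifs at h with hi
  cases h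
  exact ⟨hi, rfl, (A.privLink.symm ⟨i, hi⟩).2⟩

theorem Alloc.isSome_src_w {A : Alloc n} {i : Fin (2 ^ n)} :
    (A.src .w i).isSome ↔ i ∈ A.tgtW := by
  simp only [Alloc.src]
  split_ifs with h <;> simp [h]

theorem Alloc.isSome_src_v {A : Alloc n} {i : Fin (2 ^ n)} :
    (A.src .v i).isSome ↔ i ∈ A.tgtV := by
  simp only [Alloc.src]
  split_ifs with h <;> simp [h]

theorem Alloc.src_eq_some {A : Alloc n} {M : Model Y} {β : ℝ} (hA : A.Sound M β) {l : Layer}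
    {i : Fin (2 ^ n)} {p : Layer × Fin (2 ^ n)} (h : A.src l i = some p) :
    A.dst p.1 p.2 = some (l, i) := by
  cases l
  · simp only [Alloc.src] at h
    split_ifs at h with hi
    rcases hq : A.pubLink.symm ⟨i, hi⟩ with a | a
    · rw [hq] at h; cases h
      rw [Equiv.symm_apply_eq] at hq
      simp [Alloc.dst, ← hq]
    · rw [hq] at h; cases h
      rw [Equiv.symm_apply_eq] at hq
      simp [Alloc.dst, ← hq]
  · simp only [Alloc.src] at h
    split_ifs at h with hi
    cases h
    have hP := (A.privLink.symm ⟨i, hi⟩).2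
    have hV : (A.privLink.symm ⟨i, hi⟩).val ∉ A.chainV :=
      Finset.disjoint_right.1 hA.chainV_chainP hP
    simp [Alloc.dst, hV]
  · cases h

end Allocations

/-! ### The law of a block, averaged over the random code -/

section FairBits

theorem fairBits_eq {κ : Type*} [Fintype κ] :
    fairBits κ = pmfPi fun _ : κ => PMF.uniformOfFintype Bit := by
  classical
  ext F
  rw [pmfPi_apply]
  simp only [fairBits, PMF.uniformOfFintype_apply, Finset.prod_const, Finset.card_univ]
  rw [Fintype.card_eq_nat_card, Nat.card_fun, ← ENNReal.inv_pow, Nat.cast_pow,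
    Nat.card_eq_fintype_card, Nat.card_eq_fintype_card]

theorem expect_uniform_bit_ind (a : Bit) :
    expect (PMF.uniformOfFintype Bit) (fun b => ind (b = a)) = 2⁻¹ := by
  rw [← apply_eq_expect, PMF.uniformOfFintype_apply]
  rfl

/-- Distinct fair bits take prescribed values with probability `2⁻¹` each. -/
theorem expect_fairBits_ind {κ ι : Type*} [Finite κ] [Fintype ι] (φ : ι → Prop)
    (e : {a // φ a} → κ) (he : Function.Injective e) (v : ι → Bit) :
    open Classical in
    expect (fairBits κ) (fun F => ind (∀ a, F (e a) = v a.val)) =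
      ∏ a, if φ a then (2⁻¹ : ℝ≥0∞) else 1 := by
  classical
  let _ := Fintype.ofFinite κ
  -- Rewriting the event as a product over all bits, a factor `1` for those outside the range of
  -- `e`, makes independence applicable.
  have h1 : ∀ F : κ → Bit, ind (∀ a, F (e a) = v a.val) =
      ∏ c, if h : ∃ a, e a = c then ind (F c = v h.choose.val) else 1 := by
    intro F
    have h2 : ∀ c, (if h : ∃ a, e a = c then ind (F c = v h.choose.val) else 1) =
        ind (∀ h : ∃ a, e a = c, F c = v h.choose.val) := by
      intro c
      split_ifs with h
      · exact congrArg ind (propext ⟨fun h' _ => h', fun h' => h' h⟩)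
      · exact (ind_pos fun h' => absurd h' h).symm
    simp_rw [h2, ← ind_forall]
    refine congrArg ind (propext ⟨fun h c hc => ?_, fun h a => ?_⟩)
    · conv_lhs => rw [← hc.choose_spec]
      exact h _
    · have hc : ∃ b, e b = e a := ⟨a, rfl⟩
      rw [h (e a) hc, he hc.choose_spec]
  simp_rw [h1]
  rw [fairBits_eq, expect_pmfPi_prod (fun _ : κ => PMF.uniformOfFintype Bit) fun c b =>
    if h : ∃ a, e a = c then ind (b = v h.choose.val) else 1]
  have h3 : ∀ c, expect (PMF.uniformOfFintype Bit)
      (fun b => if h : ∃ a, e a = c then ind (b = v h.choose.val) else 1) =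
      if ∃ a, e a = c then (2⁻¹ : ℝ≥0∞) else 1 := by
    intro c
    split_ifs
    · exact expect_uniform_bit_ind _
    · exact expect_const _ _
  simp_rw [h3]
  simp only [Finset.prod_ite, Finset.prod_const, one_pow, mul_one]
  congr 1
  have h4 : (Finset.univ.filter fun c => ∃ a, e a = c) = Finset.univ.image e := by
    ext c; simp
  rw [h4, Finset.card_image_of_injective _ he, Finset.card_univ, Fintype.card_subtype]

end FairBits

section Encoder

variable {Y : Rcv → Type*} {n k : ℕ} {M : Model Y} {β : ℝ} {A : Alloc n}

/-- The slot whose message or frozen bit is used at position `i` of layer `l` of block `t`: a slot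
of the previous block at the copy targets, the position itself elsewhere. -/
def Alloc.sourceSlot (A : Alloc n) (t : Fin k) (l : Layer) (i : Fin (2 ^ n)) : Slot k n :=
  if 0 < t.val then
    match A.src l i with
    | some p => (⟨t.val - 1, (Nat.sub_le _ _).trans_lt t.isLt⟩, p)
    | none => (t, l, i)
  else (t, l, i)

theorem filled_eq (F : Slot k n → Bit) (t : Fin k) (l : Layer) (i : Fin (2 ^ n)) :
    filled A F t l i = F (A.sourceSlot t l i) := by
  unfold filled Alloc.sourceSlot
  split_ifs
  · cases A.src l i <;> rfl
  · rfl

theorem Alloc.sourceSlot_of_not_copied {t : Fin k} {l : Layer} {i : Fin (2 ^ n)}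
    (h : ¬A.IsCopied (t, l, i)) : A.sourceSlot t l i = (t, l, i) := by
  unfold Alloc.sourceSlot
  split_ifs with ht
  · have hn : A.src l i = none := by
      by_contra hne
      exact h ⟨ht, Option.isSome_iff_ne_none.2 hne⟩
    rw [hn]
  · rfl

theorem Alloc.sourceSlot_of_src {t : Fin k} (ht : 0 < t.val) {l : Layer} {i : Fin (2 ^ n)}
    {p : Layer × Fin (2 ^ n)} (h : A.src l i = some p) :
    A.sourceSlot t l i = (⟨t.val - 1, (Nat.sub_le _ _).trans_lt t.isLt⟩, p) := by
  unfold Alloc.sourceSlot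
  rw [if_pos ht, h]

theorem Alloc.sourceSlot_cases (t : Fin k) (l : Layer) (i : Fin (2 ^ n)) :
    (¬A.IsCopied (t, l, i) ∧ A.sourceSlot t l i = (t, l, i)) ∨
      ∃ p, 0 < t.val ∧ A.src l i = some p ∧
        A.sourceSlot t l i = (⟨t.val - 1, (Nat.sub_le _ _).trans_lt t.isLt⟩, p) := by
  by_cases h : A.IsCopied (t, l, i)
  · obtain ⟨p, hp⟩ := Option.isSome_iff_exists.1 h.2
    exact Or.inr ⟨p, h.1, hp, sourceSlot_of_src h.1 hp⟩
  · exact Or.inl ⟨h, sourceSlot_of_not_copied h⟩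

/-- Within a block distinct positions use distinct bits. -/
theorem Alloc.Sound.sourceSlot_injective (hA : A.Sound M β) (t : Fin k) {p q : Layer × Fin (2 ^ n)}
    (h : A.sourceSlot t p.1 p.2 = A.sourceSlot t q.1 q.2) : p = q := by
  rcases A.sourceSlot_cases t p.1 p.2 with ⟨-, h1⟩ | ⟨a, ht, h1, h1'⟩ <;>
  rcases A.sourceSlot_cases t q.1 q.2 with ⟨-, h2⟩ | ⟨b, ht', h2, h2'⟩
  · rw [h1, h2] at h
    exact congrArg Prod.snd h
  · rw [h1, h2'] at h
    have := congrArg (fun s => s.1.val) h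
    simp only at this
    omega
  · rw [h1', h2] at h
    have := congrArg (fun s => s.1.val) h
    simp only at this
    omega
  · rw [h1', h2'] at h
    have hab : a = b := congrArg Prod.snd h
    have e1 := src_eq_some hA h1
    rw [hab, src_eq_some hA h2] at e1
    exact (Option.some_injective _ e1).symm

/-- A bit that is repeated in the next block is a message bit. -/
theorem Alloc.public_or_private_of_src {t : Fin k} (ht : t.val + 1 < k) {l : Layer}
    {i : Fin (2 ^ n)} {p : Layer × Fin (2 ^ n)} (h : A.src l i = some p) :
    A.IsPublic (t, p) ∨ A.IsPrivate (t, p) := by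
  obtain ⟨l', i'⟩ := p
  cases l
  · rcases (src_w_eq_some h).2 with ⟨h1, h2⟩ | ⟨h1, h2⟩
    · cases h1; exact Or.inl (Or.inr ⟨h2, ht⟩)
    · cases h1; exact Or.inl ⟨h2, ht⟩
  · obtain ⟨-, h1, h2⟩ := src_v_eq_some h
    cases h1; exact Or.inr (Or.inr ⟨h2, ht⟩)
  · cases h

theorem Alloc.sourceSlot_kind (t : Fin k) {l : Layer} {i : Fin (2 ^ n)}
    (hi : i ∈ M.setH n β l) (h0 : ¬A.IsPublic (A.sourceSlot t l i))
    (h1 : ¬A.IsPrivate (A.sourceSlot t l i)) : A.IsFrozen M β (A.sourceSlot t l i) := by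
  rcases A.sourceSlot_cases t l i with ⟨hc, h⟩ | ⟨p, ht, hp, h⟩
  · rw [h] at h0 h1 ⊢
    exact ⟨hi, h0, h1, hc⟩
  · rw [h] at h0 h1
    rcases A.public_or_private_of_src (t := ⟨t.val - 1, (Nat.sub_le _ _).trans_lt t.isLt⟩)
      (show t.val - 1 + 1 < k by have := t.isLt; omega) hp with h' | h'
    exacts [absurd h' h0, absurd h' h1]

theorem placed_public {m₀ : PubMsg A k} {m₁ : PrivMsg A k} {c : FrozenBits A M β k}
    {s : Slot k n} (h : A.IsPublic s) : placed A M β m₀ m₁ c s = m₀ ⟨s, h⟩ := dif_pos h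

theorem placed_private {m₀ : PubMsg A k} {m₁ : PrivMsg A k} {c : FrozenBits A M β k}
    {s : Slot k n} (h0 : ¬A.IsPublic s) (h : A.IsPrivate s) :
    placed A M β m₀ m₁ c s = m₁ ⟨s, h⟩ := by
  rw [placed, dif_neg h0, dif_pos h]

theorem placed_frozen {m₀ : PubMsg A k} {m₁ : PrivMsg A k} {c : FrozenBits A M β k}
    {s : Slot k n} (h : A.IsFrozen M β s) : placed A M β m₀ m₁ c s = c ⟨s, h⟩ := by
  rw [placed, dif_neg h.2.1, dif_neg h.2.2.1, dif_pos h]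

/-- The message and frozen bits in the high-entropy positions of a block are independent and
fair. -/
theorem expect_placed (hA : A.Sound M β) (t : Fin k) (u : Layer → Word n) :
    expect (codeLaw A M β k) (fun c => expect (fairBits _) fun m₀ => expect (fairBits _) fun m₁ =>
        ind (∀ p : Layer × Fin (2 ^ n), p.2 ∈ M.setH n β p.1 →
          placed A M β m₀ m₁ c (A.sourceSlot t p.1 p.2) = u p.1 p.2)) =
      ∏ p : Layer × Fin (2 ^ n), if p.2 ∈ M.setH n β p.1 then (2⁻¹ : ℝ≥0∞) else 1 := by
  classical
  -- The positions are sorted by where their bits come from: `M₀`, `M₁` or the code.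
  let φ₀ : Layer × Fin (2 ^ n) → Prop := fun p => p.2 ∈ M.setH n β p.1 ∧
    A.IsPublic (A.sourceSlot t p.1 p.2)
  let φ₁ : Layer × Fin (2 ^ n) → Prop := fun p => p.2 ∈ M.setH n β p.1 ∧
    ¬A.IsPublic (A.sourceSlot t p.1 p.2) ∧ A.IsPrivate (A.sourceSlot t p.1 p.2)
  let φ₂ : Layer × Fin (2 ^ n) → Prop := fun p => p.2 ∈ M.setH n β p.1 ∧
    ¬A.IsPublic (A.sourceSlot t p.1 p.2) ∧ ¬A.IsPrivate (A.sourceSlot t p.1 p.2)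
  let e₀ : {p // φ₀ p} → {s : Slot k n // A.IsPublic s} := fun p => ⟨_, p.2.2⟩
  let e₁ : {p // φ₁ p} → {s : Slot k n // A.IsPrivate s} := fun p => ⟨_, p.2.2.2⟩
  let e₂ : {p // φ₂ p} → {s : Slot k n // A.IsFrozen M β s} :=
    fun p => ⟨_, A.sourceSlot_kind t p.2.1 p.2.2.1 p.2.2.2⟩
  have i₀ : Function.Injective e₀ := fun p q h =>
    Subtype.ext (hA.sourceSlot_injective t (congrArg Subtype.val h))
  have i₁ : Function.Injective e₁ := fun p q h =>
    Subtype.ext (hA.sourceSlot_injective t (congrArg Subtype.val h))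
  have i₂ : Function.Injective e₂ := fun p q h =>
    Subtype.ext (hA.sourceSlot_injective t (congrArg Subtype.val h))
  let v : Layer × Fin (2 ^ n) → Bit := fun p => u p.1 p.2
  have hsplit : ∀ (m₀ : PubMsg A k) (m₁ : PrivMsg A k) (c : FrozenBits A M β k),
      ind (∀ p : Layer × Fin (2 ^ n), p.2 ∈ M.setH n β p.1 →
          placed A M β m₀ m₁ c (A.sourceSlot t p.1 p.2) = u p.1 p.2) =
        ind (∀ a, c (e₂ a) = v a.val) * (ind (∀ a, m₀ (e₀ a) = v a.val) *
          ind (∀ a, m₁ (e₁ a) = v a.val)) := by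
    intro m₀ m₁ c
    rw [← ind_and, ← ind_and]
    refine congrArg ind (propext ⟨fun h => ⟨fun a => ?_, fun a => ?_, fun a => ?_⟩, ?_⟩)
    · exact (placed_frozen (A.sourceSlot_kind t a.2.1 a.2.2.1 a.2.2.2)).symm.trans (h a.1 a.2.1)
    · exact (placed_public a.2.2).symm.trans (h a.1 a.2.1)
    · exact (placed_private a.2.2.1 a.2.2.2).symm.trans (h a.1 a.2.1)
    · rintro ⟨h2, h0, h1⟩ p hp
      by_cases hq0 : A.IsPublic (A.sourceSlot t p.1 p.2)
      · exact (placed_public hq0).trans (h0 ⟨p, hp, hq0⟩)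
      · by_cases hq1 : A.IsPrivate (A.sourceSlot t p.1 p.2)
        · exact (placed_private hq0 hq1).trans (h1 ⟨p, hp, hq0, hq1⟩)
        · exact (placed_frozen (A.sourceSlot_kind t hp hq0 hq1)).trans (h2 ⟨p, hp, hq0, hq1⟩)
  simp_rw [hsplit, expect_mul_left, expect_mul_right, codeLaw]
  rw [expect_fairBits_ind φ₀ e₀ i₀, expect_fairBits_ind φ₁ e₁ i₁, expect_fairBits_ind φ₂ e₂ i₂,
    ← Finset.prod_mul_distrib, ← Finset.prod_mul_distrib]
  refine Finset.prod_congr rfl fun p _ => ?_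
  by_cases hp : p.2 ∈ M.setH n β p.1 <;>
  by_cases hq0 : A.IsPublic (A.sourceSlot t p.1 p.2) <;>
  by_cases hq1 : A.IsPrivate (A.sourceSlot t p.1 p.2) <;>
  simp [φ₀, φ₁, φ₂, hp, hq0, hq1]

/-- The common randomness of a block reproduces the true conditional laws. -/
theorem expect_shared (ρ : SharedRule M n β) (t : Fin k) (u : Layer → Word n) :
    expect (ρ.sharedLaw k) (fun r => ind (∀ p : Layer × Fin (2 ^ n), p.2 ∈ M.setR n β p.1 →
        r (t, p) (ctxAt u p.1 p.2) = u p.1 p.2)) =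
      ∏ p : Layer × Fin (2 ^ n),
        if p.2 ∈ M.setR n β p.1 then M.encProb n p.1 p.2 (ctxAt u p.1 p.2) (u p.1 p.2) else 1 := by
  have h1 : ∀ r : Shared k n, ind (∀ p : Layer × Fin (2 ^ n), p.2 ∈ M.setR n β p.1 →
        r (t, p) (ctxAt u p.1 p.2) = u p.1 p.2) =
      ∏ s : Slot k n, ind (s.1 = t ∧ s.2.2 ∈ M.setR n β s.2.1 →
        r s (ctxAt u s.2.1 s.2.2) = u s.2.1 s.2.2) := by
    intro r
    rw [← ind_forall]
    refine congrArg ind (propext ⟨?_, fun h p hp => h (t, p) ⟨rfl, hp⟩⟩)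
    rintro h ⟨t', p⟩ ⟨rfl, hp⟩
    exact h p hp
  simp_rw [h1, SharedRule.sharedLaw]
  rw [expect_pmfPi_prod (fun s : Slot k n => ρ.law s.2.1 s.2.2) fun s f =>
    ind (s.1 = t ∧ s.2.2 ∈ M.setR n β s.2.1 → f (ctxAt u s.2.1 s.2.2) = u s.2.1 s.2.2),
    Fintype.prod_prod_type, Finset.prod_eq_single t]
  · refine Finset.prod_congr rfl fun p _ => ?_
    split_ifs with hp
    · rw [← ρ.marginal p.1 p.2 hp, map_eq_expect]
      simp [hp]
    · simp [hp, ind_pos, expect_const]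
  · intro t' _ ht'
    refine Finset.prod_eq_one fun p _ => ?_
    simp [ht', ind_pos, expect_const]
  · simp

theorem encode_eq_iff (hd : ∀ l, Disjoint (M.setH n β l) (M.setL n β l)) (m₀ : PubMsg A k)
    (m₁ : PrivMsg A k) (c : FrozenBits A M β k) (r : Shared k n) (t : Fin k)
    (u : Layer → Word n) :
    encode A M β m₀ m₁ c r t = u ↔
      (∀ p : Layer × Fin (2 ^ n), p.2 ∈ M.setH n β p.1 →
        placed A M β m₀ m₁ c (A.sourceSlot t p.1 p.2) = u p.1 p.2) ∧
      (∀ p : Layer × Fin (2 ^ n), p.2 ∈ M.setR n β p.1 →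
        r (t, p) (ctxAt u p.1 p.2) = u p.1 p.2) ∧
      ∀ p : Layer × Fin (2 ^ n), p.2 ∈ M.setL n β p.1 →
        u p.1 p.2 = argmaxBit (M.encProb n p.1 p.2 (ctxAt u p.1 p.2)) := by
  unfold encode
  rw [layered_eq_iff]
  simp_rw [filled_eq]
  refine ⟨fun h => ⟨fun p hp => ?_, fun p hp => ?_, fun p hp => ?_⟩, fun ⟨h1, h2, h3⟩ l i => ?_⟩
  · have := h p.1 p.2
    rwa [if_pos hp] at this
  · have := h p.1 p.2
    rw [Model.setR, Finset.mem_compl, Finset.mem_union, not_or] at hp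
    rwa [if_neg hp.1, if_neg hp.2] at this
  · have := h p.1 p.2
    rw [if_neg (Finset.disjoint_right.1 (hd _) hp), if_pos hp] at this
    exact this.symm
  · split_ifs with hH hL
    · exact h1 (l, i) hH
    · exact (h3 (l, i) hL).symm
    · exact h2 (l, i) (by
        rw [Model.setR, Finset.mem_compl, Finset.mem_union, not_or]; exact ⟨hH, hL⟩)

theorem expect_msgLaw (f : PubMsg A k × PrivMsg A k → ℝ≥0∞) :
    expect (msgLaw A k) f =
      expect (fairBits _) fun m₀ => expect (fairBits _) fun m₁ => f (m₀, m₁) := by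
  unfold msgLaw
  rw [expect_bind]
  simp_rw [expect_map]

theorem expect_blockLaw (ρ : SharedRule M n β) (c : FrozenBits A M β k) (t : Fin k)
    (f : (Layer → Word n) → ℝ≥0∞) :
    expect (blockLaw A M β ρ c t) f = expect (msgLaw A k) fun m =>
      expect (ρ.sharedLaw k) fun r => f (encode A M β m.1 m.2 c r t) := by
  unfold blockLaw
  rw [expect_bind]
  simp_rw [expect_map]

/-- Averaged over the random code, each block has the law `Q`. -/
theorem expect_blockLaw_apply (hA : A.Sound M β) (hβ : 0 < β) (hn : 1 ≤ n)
    (ρ : SharedRule M n β) (t : Fin k) (u : Layer → Word n) :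
    expect (codeLaw A M β k) (fun c => blockLaw A M β ρ c t u) = M.Q n β u := by
  have hd := M.disjoint_setH_setL hβ hn
  simp_rw [apply_eq_expect (blockLaw A M β ρ _ t) u, expect_blockLaw, encode_eq_iff hd, ind_and,
    expect_mul_left, expect_mul_right, expect_shared, expect_msgLaw]
  rw [expect_placed hA, M.Q_eq_kernelProd hβ hn, ind_forall, kernelProd, ← Fintype.prod_prod_type',
    ← Finset.prod_mul_distrib, ← Finset.prod_mul_distrib]
  refine Finset.prod_congr rfl fun p _ => ?_
  have hdp : p.2 ∈ M.setH n β p.1 → p.2 ∉ M.setL n β p.1 := fun h =>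
    Finset.disjoint_left.1 (hd p.1) h
  have hR : p.2 ∈ M.setR n β p.1 ↔ p.2 ∉ M.setH n β p.1 ∧ p.2 ∉ M.setL n β p.1 := by
    rw [Model.setR, Finset.mem_compl, Finset.mem_union, not_or]
  by_cases hH : p.2 ∈ M.setH n β p.1
  · simp [Model.encKernel, hR, hH, hdp hH, ind_pos]
  · by_cases hL : p.2 ∈ M.setL n β p.1
    · simp [Model.encKernel, hR, hH, hL]
    · simp [Model.encKernel, hR, hH, hL, ind_pos]

end Encoder

/-! ### Correctness of the decoders -/

section Decoders

variable {Y : Rcv → Type*} {n k : ℕ} {M : Model Y} {β : ℝ} {A : Alloc n}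

theorem Alloc.Sound.mem_setH_of_public (hA : A.Sound M β) {s : Slot k n} (h : A.IsPublic s) :
    s.2.2 ∈ M.setH n β s.2.1 := by
  obtain ⟨t, l, i⟩ := s
  cases l
  · rcases h with h | h
    · exact M.setI_subset_setH _ _ _ _ (hA.pubW_r3 h)
    · exact M.setI_subset_setH _ _ _ _ (hA.chainW_r3 h.1)
  · exact M.setI_subset_setH _ _ _ _ (hA.chainV_r3 h.1)
  · exact h.elim

theorem Alloc.Sound.mem_setH_of_private (hA : A.Sound M β) {s : Slot k n} (h : A.IsPrivate s) :
    s.2.2 ∈ M.setH n β s.2.1 := by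
  obtain ⟨t, l, i⟩ := s
  cases l
  · exact h.elim
  · rcases h with h | h
    · exact M.setI_subset_setH _ _ _ _ (hA.privV_r1 h)
    · exact M.setI_subset_setH _ _ _ _ (hA.chainP_r3 h.1)
  · exact M.setI_subset_setH _ _ _ _ (hA.privX_r1 h)

theorem Alloc.Sound.not_copied_of_public (hA : A.Sound M β) {s : Slot k n} (h : A.IsPublic s) :
    ¬A.IsCopied s := by
  rintro ⟨-, hc⟩
  obtain ⟨t, l, i⟩ := s
  cases l
  · have hi := Finset.disjoint_left.1 hA.tgtW_r3 (isSome_src_w.1 hc)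
    rcases h with h | h
    exacts [hi (hA.pubW_r3 h), hi (hA.chainW_r3 h.1)]
  · exact Finset.disjoint_left.1 hA.tgtV_r3 (isSome_src_v.1 hc) (hA.chainV_r3 h.1)
  · exact h

theorem Alloc.Sound.not_copied_of_private (hA : A.Sound M β) {s : Slot k n}
    (h : A.IsPrivate s) : ¬A.IsCopied s := by
  rintro ⟨-, hc⟩
  obtain ⟨t, l, i⟩ := s
  cases l
  · exact h
  · have hT := isSome_src_v.1 hc
    have hi := Finset.disjoint_left.1 hA.tgtV_r3 hT
    rcases h with h | h
    · rcases hA.privV_r3 with h' | h'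
      · exact hi (h' h)
      · rw [h'.2] at hT
        exact Finset.notMem_empty _ hT
    · exact hi (hA.chainP_r3 h.1)
  · simp [Alloc.src] at hc

theorem Alloc.Sound.not_public_of_private (hA : A.Sound M β) {s : Slot k n}
    (h : A.IsPrivate s) : ¬A.IsPublic s := by
  obtain ⟨t, l, i⟩ := s
  cases l
  · exact h.elim
  · rintro ⟨h', -⟩
    rcases h with h | h
    · exact Finset.disjoint_left.1 hA.chainV_privV h' h
    · exact Finset.disjoint_left.1 hA.chainV_chainP h' h.1
  · exact id

theorem Alloc.mem_setH_of_src (hA : A.Sound M β) {l : Layer} {i : Fin (2 ^ n)}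
    (h : (A.src l i).isSome) : i ∈ M.setH n β l := by
  cases l
  · exact M.setI_subset_setH _ _ _ _ (hA.tgtW_r2 (isSome_src_w.1 h))
  · exact M.setI_subset_setH _ _ _ _ (hA.tgtV_r1 (isSome_src_v.1 h))
  · simp [Alloc.src] at h

theorem encode_eq_placed (hd : ∀ l, Disjoint (M.setH n β l) (M.setL n β l))
    {m₀ : PubMsg A k} {m₁ : PrivMsg A k} {c : FrozenBits A M β k} {r : Shared k n} {t : Fin k}
    {l : Layer} {i : Fin (2 ^ n)} (hi : i ∈ M.setH n β l) (hc : ¬A.IsCopied (t, l, i)) :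
    encode A M β m₀ m₁ c r t l i = placed A M β m₀ m₁ c (t, l, i) := by
  rw [← A.sourceSlot_of_not_copied hc]
  exact (((encode_eq_iff hd m₀ m₁ c r t _).1 rfl).1 (l, i) hi).symm

theorem encode_public (hA : A.Sound M β) (hd : ∀ l, Disjoint (M.setH n β l) (M.setL n β l))
    (m₀ : PubMsg A k) (m₁ : PrivMsg A k) (c : FrozenBits A M β k) (r : Shared k n)
    (s : {s : Slot k n // A.IsPublic s}) :
    encode A M β m₀ m₁ c r s.val.1 s.val.2.1 s.val.2.2 = m₀ s :=
  (encode_eq_placed hd (hA.mem_setH_of_public s.2) (hA.not_copied_of_public s.2)).trans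
    (placed_public s.2)

theorem encode_private (hA : A.Sound M β) (hd : ∀ l, Disjoint (M.setH n β l) (M.setL n β l))
    (m₀ : PubMsg A k) (m₁ : PrivMsg A k) (c : FrozenBits A M β k) (r : Shared k n)
    (s : {s : Slot k n // A.IsPrivate s}) :
    encode A M β m₀ m₁ c r s.val.1 s.val.2.1 s.val.2.2 = m₁ s :=
  (encode_eq_placed hd (hA.mem_setH_of_private s.2) (hA.not_copied_of_private s.2)).trans
    (placed_private (hA.not_public_of_private s.2) s.2)

/-- A copy target carries the same bit as its source in the previous block. -/
theorem encode_src (hA : A.Sound M β) (hd : ∀ l, Disjoint (M.setH n β l) (M.setL n β l))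
    (m₀ : PubMsg A k) (m₁ : PrivMsg A k) (c : FrozenBits A M β k) (r : Shared k n) {t : Fin k}
    (ht : 0 < t.val) {l : Layer} {i : Fin (2 ^ n)} {p : Layer × Fin (2 ^ n)}
    (h : A.src l i = some p) :
    encode A M β m₀ m₁ c r ⟨t.val - 1, (Nat.sub_le _ _).trans_lt t.isLt⟩ p.1 p.2 =
      encode A M β m₀ m₁ c r t l i := by
  have hi : i ∈ M.setH n β l := Alloc.mem_setH_of_src hA (by rw [h]; rfl)
  have e : placed A M β m₀ m₁ c (A.sourceSlot t l i) = encode A M β m₀ m₁ c r t l i :=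
    ((encode_eq_iff hd m₀ m₁ c r t _).1 rfl).1 (l, i) hi
  rw [← e, Alloc.sourceSlot_of_src ht h]
  have hk : t.val - 1 + 1 < k := by have := t.isLt; omega
  have h' := A.public_or_private_of_src (t := ⟨t.val - 1, (Nat.sub_le _ _).trans_lt t.isLt⟩) hk h
  set s : Slot k n := (⟨t.val - 1, (Nat.sub_le _ _).trans_lt t.isLt⟩, p)
  have hs : s.2.2 ∈ M.setH n β s.2.1 ∧ ¬A.IsCopied s := by
    rcases h' with h' | h'
    · exact ⟨hA.mem_setH_of_public h', hA.not_copied_of_public h'⟩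
    · exact ⟨hA.mem_setH_of_private h', hA.not_copied_of_private h'⟩
  exact encode_eq_placed (t := s.1) (l := s.2.1) (i := s.2.2) hd hs.1 hs.2

theorem encode_dst (hA : A.Sound M β) (hd : ∀ l, Disjoint (M.setH n β l) (M.setL n β l))
    (m₀ : PubMsg A k) (m₁ : PrivMsg A k) (c : FrozenBits A M β k) (r : Shared k n) {t : Fin k}
    (ht : t.val + 1 < k) {l : Layer} {i : Fin (2 ^ n)} {p : Layer × Fin (2 ^ n)}
    (h : A.dst l i = some p) :
    encode A M β m₀ m₁ c r ⟨t.val + 1, ht⟩ p.1 p.2 = encode A M β m₀ m₁ c r t l i :=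
  (encode_src hA hd m₀ m₁ c r (t := ⟨t.val + 1, ht⟩) (Nat.succ_pos _)
    (Alloc.dst_eq_some h)).symm

/-- A bit known from the neighbouring block is output whatever has been decoded before it. -/
theorem scDecode_of_known {j : Rcv} {c : FrozenBits A M β k} {r : Shared k n} {t : Fin k}
    {known : Layer → Fin (2 ^ n) → Option Bit} {y : Fin (2 ^ n) → Y j} {l : Layer}
    {i : Fin (2 ^ n)} (hi : i ∈ M.setH n β l) {b : Bit} (h : known l i = some b) :
    scDecode A M β j c r t known y l i = b := by
  unfold scDecode
  rw [layered_apply, if_pos hi, h]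

/-- Successive cancellation decoding recovers an initial segment of the layers of a decodable block,
provided that there the bits known from the neighbouring block are right and the positions that are
neither known nor information positions of the receiver are frozen. -/
theorem scDecode_eq_encode (hd : ∀ l, Disjoint (M.setH n β l) (M.setL n β l))
    {m₀ : PubMsg A k} {m₁ : PrivMsg A k} {c : FrozenBits A M β k} {r : Shared k n} {t : Fin k}
    {y : Fin (2 ^ n) → ∀ j, Y j} (hy : M.Decodable β (encode A M β m₀ m₁ c r t) y) (j : Rcv)
    {known : Layer → Fin (2 ^ n) → Option Bit} {ok : Layer → Prop} (hv : ok .v → ok .w)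
    (hx : ok .x → ok .v)
    (h1 : ∀ l, ok l → ∀ i b, known l i = some b → b = encode A M β m₀ m₁ c r t l i)
    (h2 : ∀ l, ok l → ∀ i ∈ M.setH n β l, known l i = none → i ∉ M.setI n β j l →
      A.IsFrozen M β (t, l, i)) :
    ∀ l, ok l →
      scDecode A M β j c r t known (fun i => y i j) l = encode A M β m₀ m₁ c r t l := by
  have hspec := (encode_eq_iff hd m₀ m₁ c r t _).1 rfl
  unfold scDecode
  refine layered_eq_of hv hx fun l hl i => ?_
  by_cases hH : i ∈ M.setH n β l
  · rw [if_pos hH]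
    rcases hk : known l i with _ | b
    · dsimp only
      split_ifs with hI hF
      · exact (hy j l i (Finset.mem_union_left _ hI)).symm
      · exact (encode_eq_placed hd hH hF.2.2.2).trans (placed_frozen hF)
      · exact absurd (h2 l hl i hH hk hI) hF
    · exact (h1 l hl i b hk).symm
  · rw [if_neg hH]
    split_ifs with hL
    · exact (hy j l i (Finset.mem_union_right _ hL)).symm
    · refine (hspec.2.1 (l, i) ?_).symm
      rw [Model.setR, Finset.mem_compl, Finset.mem_union, not_or]
      exact ⟨hH, hL⟩

theorem forwardPass_eq {γ : Type*} (step : Fin k → Option γ → γ) (t : Fin k) :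
    forwardPass step t = step t (if 0 < t.val then
      some (forwardPass step ⟨t.val - 1, (Nat.sub_le _ _).trans_lt t.isLt⟩) else none) := by
  rw [forwardPass]
  rfl

theorem backwardPass_eq {γ : Type*} (step : Fin k → Option γ → γ) (t : Fin k) :
    backwardPass step t = step t (if h : t.val + 1 < k then
      some (backwardPass step ⟨t.val + 1, h⟩) else none) := by
  rw [backwardPass]

/-- The decoder of a receiver that processes the blocks in decreasing order. -/
noncomputable def backwardDecode (A : Alloc n) (M : Model Y) (β : ℝ) (j : Rcv)
    (c : FrozenBits A M β k) (r : Shared k n) (y : Fin k → Fin (2 ^ n) → Y j) :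
    Fin k → Layer → Word n :=
  backwardPass fun t next => scDecode A M β j c r t
    (fun l i => next.bind fun U => (A.dst l i).map fun p => U p.1 p.2) (y t)

variable (hA : A.Sound M β) (hd : ∀ l, Disjoint (M.setH n β l) (M.setL n β l))
  {m₀ : PubMsg A k} {m₁ : PrivMsg A k} {c : FrozenBits A M β k} {r : Shared k n}
  {y : Fin k → Fin (2 ^ n) → ∀ j, Y j}
  (hy : ∀ t, M.Decodable β (encode A M β m₀ m₁ c r t) (y t))

include hA hd hy

/-- Backward decoding is right in an initial segment of the layers that is closed under copying. -/
theorem backwardDecode_eq (j : Rcv) {ok : Layer → Prop} (hv : ok .v → ok .w) (hx : ok .x → ok .v)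
    (hdst : ∀ l, ok l → ∀ i p, A.dst l i = some p → ok p.1)
    (hfr : ∀ l, ok l → ∀ t : Fin k, ∀ i ∈ M.setH n β l, (t.val + 1 < k → A.dst l i = none) →
      i ∉ M.setI n β j l → A.IsFrozen M β (t, l, i)) (t : Fin k) :
    ∀ l, ok l → backwardDecode A M β j c r (fun t i => y t i j) t l =
      encode A M β m₀ m₁ c r t l := by
  induction hm : k - t.val using Nat.strong_induction_on generalizing t with
  | _ m ih =>
    unfold backwardDecode
    rw [backwardPass_eq]
    refine scDecode_eq_encode hd (hy t) j hv hx (fun l hl i b hb => ?_) fun l hl i hi hb hI => ?_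
    · split_ifs at hb with ht
      · obtain ⟨p, hp, hb⟩ := Option.map_eq_some_iff.1 hb
        rw [← hb, ← encode_dst hA hd m₀ m₁ c r ht hp]
        exact congrFun (ih (k - (t.val + 1)) (by omega) ⟨t.val + 1, ht⟩ rfl p.1
          (hdst l hl i p hp)) p.2
      · cases hb
    · refine hfr l hl t i hi (fun ht => ?_) hI
      rw [dif_pos ht] at hb
      exact Option.map_eq_none_iff.1 hb

/-- Receiver 1 recovers all the layers. Its channel is better than that of receiver 2, so that it
can decode the copy targets of layer `w`. -/
theorem decodeBlocks_r1 :
    decodeBlocks A M β .r1 c r (fun t i => y t i .r1) = encode A M β m₀ m₁ c r := by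
  funext t l
  refine backwardDecode_eq hA hd hy .r1 (ok := fun _ => True) id id (fun _ _ _ _ _ => trivial)
    (fun l _ t i hi hdst hI => ⟨hi, ?_, ?_, ?_⟩) t l trivial
  · cases l
    · rintro (h | ⟨h, ht⟩)
      · exact hI (M.setI_r2_subset_r1 n β .w (hA.pubW_r2 h))
      · simpa [Alloc.dst, h] using hdst ht
    · rintro ⟨h, ht⟩
      simpa [Alloc.dst, h] using hdst ht
    · exact id
  · cases l
    · exact id
    · rintro (h | ⟨h, ht⟩)
      · exact hI (hA.privV_r1 h)
      · have := hdst ht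
        simp only [Alloc.dst] at this
        split_ifs at this
    · exact fun h => hI (hA.privX_r1 h)
  · rintro ⟨-, h⟩
    cases l
    · exact hI (M.setI_r2_subset_r1 n β .w (hA.tgtW_r2 (Alloc.isSome_src_w.1 h)))
    · exact hI (hA.tgtV_r1 (Alloc.isSome_src_v.1 h))
    · simp [Alloc.src] at h

/-- Receiver 2 recovers layer `w`. -/
theorem decodeBlocks_r2_w (t : Fin k) :
    decodeBlocks A M β .r2 c r (fun t i => y t i .r2) t .w =
      encode A M β m₀ m₁ c r t .w := by
  refine backwardDecode_eq hA hd hy .r2 (ok := fun l => l = .w) (fun h => by cases h)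
    (fun h => by cases h) ?_ ?_ t .w rfl
  · rintro _ rfl i p hp
    simp only [Alloc.dst] at hp
    split_ifs at hp
    cases hp; rfl
  · rintro _ rfl t i hi hdst hI
    refine ⟨hi, ?_, id, ?_⟩
    · rintro (h | ⟨h, ht⟩)
      · exact hI (hA.pubW_r2 h)
      · simpa [Alloc.dst, h] using hdst ht
    · exact fun h => hI (hA.tgtW_r2 (Alloc.isSome_src_w.1 h.2))

/-- Receiver 2 recovers the public bits of layer `v` from their copies in layer `w` of the next
block, without decoding layer `v`. -/
theorem decodeBlocks_r2_chainV {t : Fin k} (ht : t.val + 1 < k) {i : Fin (2 ^ n)}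
    (hi : i ∈ A.chainV) :
    decodeBlocks A M β .r2 c r (fun t i => y t i .r2) t .v i =
      encode A M β m₀ m₁ c r t .v i := by
  have hp : A.dst .v i = some (.w, (A.pubLink (.inr ⟨i, hi⟩)).val) := dif_pos hi
  rw [← encode_dst hA hd m₀ m₁ c r ht hp, ← decodeBlocks_r2_w hA hd hy]
  simp only [decodeBlocks]
  rw [backwardPass_eq]
  refine scDecode_of_known (M.setI_subset_setH _ _ _ _ (hA.chainV_r3 hi)) ?_
  rw [dif_pos ht, hp]
  rfl

/-- Receiver 3 recovers layer `w` and, if there are public bits in layer `v`, also layer `v`. -/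
theorem decodeBlocks_r3 (t : Fin k) (l : Layer)
    (hl : l = .w ∨ l = .v ∧ A.privV ⊆ M.setI n β .r3 .v) :
    decodeBlocks A M β .r3 c r (fun t i => y t i .r3) t l = encode A M β m₀ m₁ c r t l := by
  simp only [decodeBlocks]
  induction hm : t.val using Nat.strong_induction_on generalizing t l with
  | _ m ih =>
    rw [forwardPass_eq]
    refine scDecode_eq_encode hd (hy t) .r3
      (ok := fun l => l = .w ∨ l = .v ∧ A.privV ⊆ M.setI n β .r3 .v) (fun _ => Or.inl rfl)
      (fun h => by rcases h with h | h; cases h; cases h.1) (fun l hl i b hb => ?_)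
      (fun l hl i hi hb hI => ⟨hi, ?_, ?_, ?_⟩) l hl
    · split_ifs at hb with ht
      · obtain ⟨p, hp, hb⟩ := Option.map_eq_some_iff.1 hb
        rw [← hb, ← encode_src hA hd m₀ m₁ c r ht hp]
        refine congrFun (ih (t.val - 1) (by omega)
          ⟨t.val - 1, (Nat.sub_le _ _).trans_lt t.isLt⟩ p.1 ?_ rfl) p.2
        rcases hl with rfl | ⟨rfl, hl⟩
        · rcases (Alloc.src_w_eq_some hp).2 with h | h
          · exact Or.inl h.1
          · refine Or.inr ⟨h.1, hA.privV_r3.resolve_right fun h' => ?_⟩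
            rw [h'.1] at h
            exact Finset.notMem_empty _ h.2
        · exact Or.inr ⟨(Alloc.src_v_eq_some hp).2.1, hl⟩
      · cases hb
    · rcases hl with rfl | ⟨rfl, hl⟩
      · rintro (h | h)
        exacts [hI (hA.pubW_r3 h), hI (hA.chainW_r3 h.1)]
      · exact fun h => hI (hA.chainV_r3 h.1)
    · rcases hl with rfl | ⟨rfl, hl⟩
      · exact id
      · rintro (h | h)
        exacts [hI (hl h), hI (hA.chainP_r3 h.1)]
    · rintro ⟨ht, h⟩
      rw [if_pos ht] at hb
      have hn : A.src l i = none := Option.map_eq_none_iff.1 hb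
      rw [hn] at h
      cases h

/-- If all the blocks are decodable, then no receiver errs. -/
theorem not_isError_of_decodable : ¬IsError A M β c ((m₀, m₁), r, y) := by
  unfold IsError
  simp only [ne_eq, not_or, not_not]
  refine ⟨?_, ?_, ?_⟩
  · rw [decodeBlocks_r1 hA hd hy]
    exact Prod.ext (funext fun s => encode_public hA hd m₀ m₁ c r s)
      (funext fun s => encode_private hA hd m₀ m₁ c r s)
  · funext s
    rw [← encode_public hA hd m₀ m₁ c r s]
    obtain ⟨⟨t, l, i⟩, hs⟩ := s
    cases l
    · exact congrFun (decodeBlocks_r2_w hA hd hy t) i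
    · exact decodeBlocks_r2_chainV hA hd hy hs.2 hs.1
    · exact hs.elim
  · funext s
    rw [← encode_public hA hd m₀ m₁ c r s]
    obtain ⟨⟨t, l, i⟩, hs⟩ := s
    cases l
    · exact congrFun (decodeBlocks_r3 hA hd hy t .w (Or.inl rfl)) i
    · refine congrFun (decodeBlocks_r3 hA hd hy t .v (Or.inr ⟨rfl, ?_⟩)) i
      refine hA.privV_r3.resolve_right fun h' => ?_
      have h := hs.1
      rw [h'.1] at h
      exact Finset.notMem_empty _ h
    · exact hs.elim

end Decoders

/-! ### The error probability -/

section ErrorProb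

variable {Y : Rcv → Type*} {n k : ℕ} {M : Model Y} {β : ℝ} {A : Alloc n}

theorem expect_transmissionLaw (ρ : SharedRule M n β) (c : FrozenBits A M β k)
    (f : (PubMsg A k × PrivMsg A k) × Shared k n × Outputs Y k n → ℝ≥0∞) :
    expect (transmissionLaw A M β ρ c) f = expect (msgLaw A k) fun m =>
      expect (ρ.sharedLaw k) fun r =>
        expect (pmfPi fun t : Fin k => M.chanN (polar (encode A M β m.1 m.2 c r t .x)))
          fun y => f (m, r, y) := by
  unfold transmissionLaw
  simp_rw [expect_bind, expect_map]
  rfl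

/-- A union bound over the blocks. -/
theorem errorProb_le (hA : A.Sound M β) (hd : ∀ l, Disjoint (M.setH n β l) (M.setL n β l))
    (ρ : SharedRule M n β) (c : FrozenBits A M β k) :
    errorProb A M β ρ c ≤ ∑ t : Fin k, expect (blockLaw A M β ρ c t) fun u =>
      expect (M.chanN (polar (u .x))) fun y => ind (¬M.Decodable β u y) := by
  rw [errorProb, toOuterMeasure_eq_expect, expect_transmissionLaw]
  simp_rw [expect_blockLaw]
  rw [← expect_sum]
  refine expect_mono _ fun m => ?_
  rw [← expect_sum]
  refine expect_mono _ fun r => ?_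
  have h1 : ∀ t : Fin k, expect (M.chanN (polar (encode A M β m.1 m.2 c r t .x)))
      (fun y => ind (¬M.Decodable β (encode A M β m.1 m.2 c r t) y)) =
      expect (pmfPi fun t : Fin k => M.chanN (polar (encode A M β m.1 m.2 c r t .x)))
        fun y => ind (¬M.Decodable β (encode A M β m.1 m.2 c r t) (y t)) := fun t =>
    (expect_pmfPi_eval (fun t : Fin k => M.chanN (polar (encode A M β m.1 m.2 c r t .x))) t
      fun y => ind (¬M.Decodable β (encode A M β m.1 m.2 c r t) y)).symm
  simp_rw [h1]
  rw [← expect_sum]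
  refine expect_mono _ fun y => ?_
  refine le_trans (ind_mono fun h => ?_) (ind_exists_le _)
  by_contra hne
  push Not at hne
  exact not_isError_of_decodable hA hd hne h

theorem expect_errorProb_le (hA : A.Sound M β) (hβ : 0 < β) (hn : 1 ≤ n)
    (ρ : SharedRule M n β) :
    expect (codeLaw A M β k) (fun c => errorProb A M β ρ c) ≤
      k * ENNReal.ofReal (12 * (2 ^ n * √(delta β n))) := by
  refine (expect_mono _ fun c =>
    errorProb_le hA (M.disjoint_setH_setL hβ hn) ρ c).trans ?_
  rw [expect_sum]
  calc _ ≤ ∑ t : Fin k, ENNReal.ofReal (12 * (2 ^ n * √(delta β n))) := by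
        refine Finset.sum_le_sum fun t _ => ?_
        simp_rw [expect_fintype (blockLaw A M β ρ _ t)]
        rw [expect_sum]
        simp_rw [expect_mul_right, expect_blockLaw_apply hA hβ hn]
        exact sum_Q_mul_not_decodable_le M hβ hn
    _ = _ := by simp

end ErrorProb

theorem sqrt_delta (β : ℝ) (n : ℕ) : √(delta β n) = (2 : ℝ) ^ (-(((2 : ℝ) ^ n) ^ β / 2)) := by
  rw [delta, Real.sqrt_eq_rpow, ← Real.rpow_mul two_pos.le]
  congr 1
  ring

open Filter in
/-- The exponent `β' < β` absorbs both the number of positions and the square root. -/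
theorem exists_mul_sqrt_delta_le {β β' : ℝ} (hβ0 : 0 < β) (hβ' : β' < β) :
    ∃ C : ℝ, 0 < C ∧ ∀ n : ℕ,
      2 ^ n * √(delta β n) ≤ C * (2 : ℝ) ^ (-(((2 : ℝ) ^ n) ^ β')) := by
  have hlog2 : 0 < Real.log 2 := Real.log_pos one_lt_two
  have hx : ∀ᶠ x : ℝ in atTop,
      x * (2 : ℝ) ^ (-(x ^ β / 2)) ≤ (2 : ℝ) ^ (-(x ^ β')) := by
    have h1 := (isLittleO_log_rpow_atTop hβ0).bound (show 0 < Real.log 2 / 4 by positivity)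
    have h2 := (tendsto_rpow_neg_atTop (sub_pos.2 hβ')).eventually_le_const
      (show (0 : ℝ) < 1 / 4 by norm_num)
    filter_upwards [h1, h2, eventually_ge_atTop 1] with x h1 h2 h3
    have hx0 : 0 < x := by linarith
    have hxβ : 0 < x ^ β := Real.rpow_pos_of_pos hx0 _
    rw [Real.norm_of_nonneg (Real.log_nonneg h3), Real.norm_of_nonneg hxβ.le] at h1
    have h4 : x ^ β' ≤ x ^ β / 4 := by
      have e : x ^ β' = x ^ (-(β - β')) * x ^ β := by
        rw [← Real.rpow_add hx0]; congr 1; ring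
      rw [e]
      nlinarith
    rw [← Real.log_le_log_iff (by positivity) (by positivity),
      Real.log_mul hx0.ne' (by positivity), Real.log_rpow two_pos, Real.log_rpow two_pos]
    nlinarith
  have hn := (tendsto_pow_atTop_atTop_of_one_lt (one_lt_two (α := ℝ))).eventually hx
  have hb : BddAbove (Set.range fun n : ℕ =>
      (2 ^ n * √(delta β n)) / (2 : ℝ) ^ (-(((2 : ℝ) ^ n) ^ β'))) := by
    refine IsBoundedUnder.bddAbove_range ⟨1, ?_⟩
    rw [eventually_map]
    filter_upwards [hn] with n hn
    rw [sqrt_delta]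
    exact (div_le_one (by positivity)).2 hn
  obtain ⟨C, hC⟩ := hb
  refine ⟨max C 1, by positivity, fun n => ?_⟩
  have h := hC ⟨n, rfl⟩
  rw [← div_le_iff₀ (by positivity)]
  exact h.trans (le_max_left _ _)

end PolarBC

theorem theorem1 {Y : Rcv → Type*} (M : Model Y) (β β' : ℝ) (hβ0 : 0 < β) (hβ : β < 1 / 2)
    (hβ' : β' < β) :
    (∀ (n k m0 m11 m12 : ℕ), 1 ≤ n →
      ∀ (A : Alloc n), A.Valid M β m0 m11 m12 → ∀ (ρ : SharedRule M n β) (t : Fin k)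
        (u : Layer → Word n),
        expect (codeLaw A M β k) (fun c => blockLaw A M β ρ c t u) = M.Q n β u) ∧
    ∃ K : ℝ, 0 < K ∧ ∀ (n k m0 m11 m12 : ℕ), 1 ≤ n → 1 ≤ k →
      ∀ (A : Alloc n), A.Valid M β m0 m11 m12 → ∀ ρ : SharedRule M n β,
        expect (codeLaw A M β k) (fun c => errorProb A M β ρ c) ≤
          ENNReal.ofReal (K * k * (2 : ℝ) ^ (-(((2 : ℝ) ^ n) ^ β'))) := by
  refine ⟨fun n k m0 m11 m12 hn A hA ρ t u => expect_blockLaw_apply hA.sound hβ0 hn ρ t u, ?_⟩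
  obtain ⟨C, hC0, hC⟩ := exists_mul_sqrt_delta_le hβ0 hβ'
  refine ⟨12 * C, by positivity, fun n k m0 m11 m12 hn _ A hA ρ => ?_⟩
  refine (expect_errorProb_le hA.sound hβ0 hn ρ).trans ?_
  rw [← ENNReal.ofReal_natCast k, ← ENNReal.ofReal_mul (Nat.cast_nonneg k)]
  refine ENNReal.ofReal_le_ofReal ?_
  calc (k : ℝ) * (12 * (2 ^ n * √(delta β n)))
      ≤ k * (12 * (C * (2 : ℝ) ^ (-(((2 : ℝ) ^ n) ^ β')))) := by
        exact mul_le_mul_of_nonneg_left (mul_le_mul_of_nonneg_left (hC n) (by norm_num))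
          (Nat.cast_nonneg k)
    _ = _ := by ring
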